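/- Let $\mathbb D=\{z\in\mathbb C: |z|<1\}$. For $a\in[0,1)$ put $\theta_a=2\arcsin a$ and let $\nu_a$ be the probability measure on the arc $\Gamma_a=\{e^{i\theta}:\theta_a\le\theta\le 2\pi-\theta_a\}$ of the unit circle with density $$\frac{d\nu_a}{d\theta}(e^{i\theta})=\frac1{2\pi}\,\frac{\sin(\theta/2)}{\sqrt{\cos^2(\theta_a/2)-\cos^2(\theta/2)}},\qquad \theta_a<\theta<2\pi-\theta_a;$$ let $\nu_1=\delta_{-1}$ be the unit mass at $-1$. (Thus $\nu_a$ is the equilibrium measure of $\Gamma_a$.) For a doubly indexed family $X_{n,N}$ write $\lim_{n/N\to s}X_{n,N}=X$ if $X_{n_j,N_j}\to X$ for all sequences of positive integers $n_j,N_j\to\infty$ with $n_j/N_j\to s$. Let $\{\alpha_{n,N}: n,N\in\mathbb N_0\}\subset\mathbb D$. For each $N$ let the monic polynomials $\Phi_{n,N}$ of degree $n$ be given by $\Phi_{0,N}=1$ and the Szegő recurrence $$\Phi_{n+1,N}(z)=z\,\Phi_{n,N}(z)-\overline{\alpha_{n,N}}\,\Phi_{n,N}^*(z),\qquad \Phi_{n,N}^*(z)=z^n\,\overline{\Phi_{n,N}(1/\bar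 z)},\qquad n\ge 0,$$ and let $\nu_{n,N}=\frac1n\sum_{j=1}^n\delta_{z_{j,n,N}}$, $n\ge1$, where $z_{1,n,N},\dots,z_{n,n,N}$ are the zeros of $\Phi_{n,N}$ counted with multiplicity. **Theorem.** Let $t>0$ and let $\alpha:[0,t]\to\overline{\mathbb D}$ be Lebesgue measurable. Suppose that $$\lim_{n/N\to s}\alpha_{n,N}=\alpha(s)\quad\text{for a.e. } s\in[0,t],\qquad\text{and}\qquad \lim_{n/N\to t}|\alpha_{n-1,N}|^{1/n}=1.$$ Then, in the sense of weak convergence of measures on $\mathbb C$, $$\lim_{n/N\to t}\nu_{n,N}=\frac1t\int_0^t\nu_{|\alpha(s)|}\,ds,$$ that is, for all $n_j,N_j\to\infty$ with $n_j/N_j\to t$ and every bounded continuous $f:\mathbb C\to\mathbb R$, $\int f\,d\nu_{n_j,N_j}\to\int f\,d\sigma_t$, where $\sigma_t(B)=\frac1t\int_0^t\nu_{|\alpha(s)|}(B)\,ds$ for Borel sets $B$. -/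

import Mathlib

open MeasureTheory Filter Topology Polynomial
open scoped ENNReal BoundedContinuousFunction

/-- `lim_{n/N → s} x_{n,N} = l`: convergence along all sequences `n_j, N_j → ∞` with
`n_j / N_j → s`. -/
def RatioTendsto {X : Type*} [TopologicalSpace X] (x : ℕ → ℕ → X) (s : ℝ) (l : X) : Prop :=
  ∀ n N : ℕ → ℕ, Tendsto n atTop atTop → Tendsto N atTop atTop →
    Tendsto (fun j => (n j : ℝ) / (N j : ℝ)) atTop (𝓝 s) →
    Tendsto (fun j => x (n j) (N j)) atTop (𝓝 l)

/-- Weak convergence `μ_{n,N} → ν` as `n/N → s`, tested on bounded continuous functions. -/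
def RatioWeakTendsto (μ : ℕ → ℕ → Measure ℂ) (s : ℝ) (ν : Measure ℂ) : Prop :=
  ∀ f : ℂ →ᵇ ℝ, RatioTendsto (fun n N => ∫ z, f z ∂(μ n N)) s (∫ z, f z ∂ν)

/-- The reversed polynomial `p^*(z) = z^n * conj (p (1 / conj z))` of a polynomial of degree at
most `n`: its coefficient of `z^k` is the conjugate of the coefficient of `z^(n-k)` in `p`. -/
noncomputable def reversedPoly (n : ℕ) (p : ℂ[X]) : ℂ[X] :=
  (p.map (starRingEnd ℂ)).reflect n

/-- The monic orthogonal polynomials on the unit circle with Verblunsky coefficients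
`a 0, a 1, …`, generated by the Szegő recurrence. -/
noncomputable def opuc (a : ℕ → ℂ) : ℕ → ℂ[X]
  | 0 => 1
  | n + 1 => X * opuc a n - C (starRingEnd ℂ (a n)) * reversedPoly n (opuc a n)

/-- The zero-counting measure `(1/n) ∑ δ_{z_j}` of the polynomial `opuc a n`; the sum runs over
its zeros, counted with multiplicity. -/
noncomputable def opucZeroMeasure (a : ℕ → ℂ) (n : ℕ) : Measure ℂ :=
  (n : ℝ≥0∞)⁻¹ • ((opuc a n).roots.map fun z => Measure.dirac z).sum

/-- The endpoint angle `θ_a = 2 arcsin a` of the arc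
`Γ_a = {e^{iθ} : θ_a ≤ θ ≤ 2π - θ_a}`. -/
noncomputable def arcAngle (a : ℝ) : ℝ := 2 * Real.arcsin a

/-- The density in `θ` of the equilibrium measure of `Γ_a`, for `0 ≤ a < 1`. -/
noncomputable def arcDensity (a θ : ℝ) : ℝ :=
  1 / (2 * Real.pi) *
    (Real.sin (θ / 2) / √(Real.cos (arcAngle a / 2) ^ 2 - Real.cos (θ / 2) ^ 2))

/-- The equilibrium measure `ν_a` of the arc `Γ_a`, `0 ≤ a ≤ 1`, as a measure on `ℂ`: absolutely
continuous on the arc if `a ≠ 1`, and the unit mass at `-1` if `a = 1`. -/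
noncomputable def arcMeasure (a : ℝ) : Measure ℂ :=
  if a = 1 then Measure.dirac (-1)
  else ((volume.restrict (Set.Icc (arcAngle a) (2 * Real.pi - arcAngle a))).withDensity
      fun θ => ENNReal.ofReal (arcDensity a θ)).map
    fun θ : ℝ => Complex.exp (θ * Complex.I)

/-- The family `a ↦ ν_a` is measurable, so that it can be averaged with `Measure.bind`. -/
theorem measurable_arcMeasure : Measurable arcMeasure := by
  have hexp : Measurable fun θ : ℝ => Complex.exp (θ * Complex.I) := by fun_prop
  have hang : Measurable arcAngle := by unfold arcAngle; fun_prop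
  have hden : Measurable fun p : ℝ × ℝ => ENNReal.ofReal (arcDensity p.1 p.2) := by
    unfold arcDensity; fun_prop
  refine Measurable.ite (measurableSet_singleton 1) measurable_const ?_
  refine Measure.measurable_of_measurable_coe _ fun s hs => ?_
  have hset : MeasurableSet {p : ℝ × ℝ | p.2 ∈ Set.Icc (arcAngle p.1)
      (2 * Real.pi - arcAngle p.1) ∧ Complex.exp (p.2 * Complex.I) ∈ s} := by
    refine MeasurableSet.inter (MeasurableSet.inter ?_ ?_) ?_
    · exact measurableSet_le (hang.comp measurable_fst) measurable_snd
    · exact measurableSet_le measurable_snd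
        (measurable_const.sub (hang.comp measurable_fst))
    · exact (hexp.comp measurable_snd) hs
  have key := (hden.indicator hset).lintegral_prod_right' (ν := (volume : Measure ℝ))
  convert key using 2 with a
  rw [Measure.map_apply hexp hs, withDensity_apply _ (hexp hs),
    Measure.restrict_restrict (hexp hs), ← lintegral_indicator
      ((hexp hs).inter measurableSet_Icc)]
  refine lintegral_congr fun θ => ?_
  classical
  simp only [Set.indicator]
  exact if_congr and_comm rfl rfl

/-- The average `(1/t) ∫_0^t ν_{|α(s)|} ds`, i.e. the measure
`B ↦ (1/t) ∫_0^t ν_{|α(s)|}(B) ds`. -/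
noncomputable def averagedArcMeasure (α : ℝ → ℂ) (t : ℝ) : Measure ℂ :=
  (ENNReal.ofReal t)⁻¹ • (volume.restrict (Set.Icc 0 t)).bind fun s => arcMeasure ‖α s‖

/-! The method of moments proves the theorem. The m-th power sum of the zeros of `Φ_n` is a
coefficient of `-X f'/f` for `f(X) = X^n Φ_n(1/X) = ∏ (1 - zⱼ X)`. The Szegő recurrence writes `f`
as a product of local factors `Φ_{k+1}(z) / (z Φ_k(z))`, `k < n`, in the variable `X = 1/z`, and the
logarithmic derivative makes the power sum additive in `k` (`sum_roots_opuc_pow`).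

Each coefficient of the local factor depends, for large `k`, only on a fixed number of the last
Verblunsky coefficients. These share the limit `α(s)` when `k/N → s`, so the factor converges
coefficientwise to the solution `h` of a quadratic equation, `fixedFactor`. Uniform bounds and
dominated convergence turn the mean over `k` into a mean over `s` (`ratioTendsto_average`).

The limit is identified in `integral_pow_arcMeasure_norm`. With `c² = 1 - |α|²`, `ν_{|α|}` is the
law of `E = exp(2i arccos(c cos φ))` for uniform `φ`, and `(1 - E X)(1 - E⁻¹ X) = h² (1 + u r)(1 +
u⁻¹ r)` with `u = e^{2iφ}` and `r(0) = 0`. Averaging logarithmic derivatives over `φ` kills the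
`u`-factors and leaves `h`.

Holomorphic moments determine a limit only on the circle. Since `∏ |zⱼ| = |α_{n-1}|`, the root
hypothesis forces the mean of `1 - |zⱼ|` to zero, and Stone–Weierstrass on the closed disk finishes
(`tendsto_integral_of_tendsto_moments`). -/

/-! ### Logarithmic derivatives of power series and power sums -/

/-- The negative logarithmic derivative `-X (df/dX) / f` of a power series. -/
noncomputable def negLogDeriv (f : PowerSeries ℂ) : PowerSeries ℂ :=
  -(PowerSeries.X * PowerSeries.derivative ℂ f * f⁻¹)

theorem negLogDeriv_mul_self {f : PowerSeries ℂ} (hf : PowerSeries.constantCoeff f ≠ 0) :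
    negLogDeriv f * f = -(PowerSeries.X * PowerSeries.derivative ℂ f) := by
  rw [negLogDeriv, neg_mul, mul_assoc, PowerSeries.inv_mul_cancel _ hf, mul_one]

theorem eq_negLogDeriv {f g : PowerSeries ℂ} (hf : PowerSeries.constantCoeff f ≠ 0)
    (h : g * f = -(PowerSeries.X * PowerSeries.derivative ℂ f)) : g = negLogDeriv f := by
  rw [negLogDeriv, ← neg_mul, ← h, mul_assoc, PowerSeries.mul_inv_cancel _ hf, mul_one]

theorem negLogDeriv_mul {f g : PowerSeries ℂ} (hf : PowerSeries.constantCoeff f ≠ 0)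
    (hg : PowerSeries.constantCoeff g ≠ 0) :
    negLogDeriv (f * g) = negLogDeriv f + negLogDeriv g := by
  symm
  apply eq_negLogDeriv
  · simpa using ⟨hf, hg⟩
  · have h1 := negLogDeriv_mul_self hf
    have h2 := negLogDeriv_mul_self hg
    rw [Derivation.leibniz]
    simp only [smul_eq_mul]
    linear_combination g * h1 + f * h2

@[simp] theorem negLogDeriv_one : negLogDeriv 1 = 0 := by
  simp [negLogDeriv]

/-- The recursion for the coefficients of the negative logarithmic derivative. -/
theorem coeff_negLogDeriv_succ {f : PowerSeries ℂ} (hf : PowerSeries.constantCoeff f = 1)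
    (m : ℕ) :
    PowerSeries.coeff (m + 1) (negLogDeriv f) = -((m + 1) * PowerSeries.coeff (m + 1) f) -
      ∑ p ∈ Finset.HasAntidiagonal.antidiagonal m,
        PowerSeries.coeff p.1 (negLogDeriv f) * PowerSeries.coeff (p.2 + 1) f := by
  have h := congrArg (PowerSeries.coeff (m + 1))
    (negLogDeriv_mul_self (f := f) (by simp [hf]))
  rw [PowerSeries.coeff_mul, Finset.Nat.sum_antidiagonal_succ', map_neg,
    PowerSeries.coeff_succ_X_mul, PowerSeries.coeff_derivative] at h
  simp only [PowerSeries.coeff_zero_eq_constantCoeff, hf] at h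
  linear_combination h

theorem coeff_zero_negLogDeriv (f : PowerSeries ℂ) :
    PowerSeries.coeff 0 (negLogDeriv f) = 0 := by
  simp [negLogDeriv]

theorem coeff_negLogDeriv_linear (z : ℂ) (m : ℕ) :
    PowerSeries.coeff (m + 1) (negLogDeriv (1 - PowerSeries.C z * PowerSeries.X)) =
      z ^ (m + 1) := by
  have hmk : (1 - PowerSeries.C z * PowerSeries.X) * PowerSeries.mk (fun n => z ^ n) = 1 := by
    ext n
    rw [sub_mul, one_mul, mul_assoc, map_sub, PowerSeries.coeff_C_mul]
    cases n with
    | zero => simp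
    | succ n => simp [PowerSeries.coeff_succ_X_mul, PowerSeries.coeff_one, pow_succ']
  have : PowerSeries.C z * PowerSeries.X * PowerSeries.mk (fun n => z ^ n) =
      negLogDeriv (1 - PowerSeries.C z * PowerSeries.X) := by
    apply eq_negLogDeriv
    · simp
    · rw [map_sub, PowerSeries.derivative_one, Derivation.leibniz]
      simp only [smul_eq_mul, PowerSeries.derivative_X, PowerSeries.derivative_C]
      linear_combination PowerSeries.C z * PowerSeries.X * hmk
  rw [← this, mul_assoc, PowerSeries.coeff_C_mul, PowerSeries.coeff_succ_X_mul]
  simp [pow_succ']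

/-- The coefficients of the negative logarithmic derivative of `f = ∏ (1 - zⱼ X)` are the power
sums of the `zⱼ`. -/
theorem coeff_negLogDeriv_prod (s : Multiset ℂ) (m : ℕ) :
    PowerSeries.coeff (m + 1)
      (negLogDeriv (s.map fun z => 1 - PowerSeries.C z * PowerSeries.X).prod) =
      (s.map fun z => z ^ (m + 1)).sum := by
  induction s using Multiset.induction_on with
  | empty => simp
  | cons z s ih =>
    rw [Multiset.map_cons, Multiset.prod_cons, negLogDeriv_mul, map_add, ih,
      coeff_negLogDeriv_linear, Multiset.map_cons, Multiset.sum_cons]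
    · simp
    · rw [map_multiset_prod, Multiset.map_map]
      simp

/-! ### The Szegő recurrence and the location of the zeros -/

theorem natDegree_reversedPoly_le {n : ℕ} {p : ℂ[X]} (hp : p.natDegree ≤ n) :
    (reversedPoly n p).natDegree ≤ n := by
  refine natDegree_reflect_le.trans (max_le le_rfl ?_)
  exact natDegree_map_le.trans hp

theorem reflect_succ {n : ℕ} {p : ℂ[X]} (hp : p.natDegree ≤ n) :
    p.reflect (n + 1) = X * p.reflect n := by
  have := reflect_mul (1 : ℂ[X]) p (F := 1) (G := n) (by simp) hp
  rwa [one_mul, add_comm, reflect_one, pow_one] at this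

theorem reflect_succ_X_mul {n : ℕ} {p : ℂ[X]} (hp : p.natDegree ≤ n) :
    (X * p).reflect (n + 1) = p.reflect n := by
  have := reflect_mul (X : ℂ[X]) p (F := 1) (G := n) (by simp) hp
  rwa [add_comm, reflect_one_X, one_mul] at this

theorem opuc_monic_and_natDegree (a : ℕ → ℂ) (n : ℕ) :
    (opuc a n).Monic ∧ (opuc a n).natDegree = n := by
  induction n with
  | zero => simp [opuc]
  | succ n ih =>
    obtain ⟨hm, hd⟩ := ih
    have hX : (X * opuc a n).Monic := monic_X.mul hm
    have hXd : (X * opuc a n).natDegree = n + 1 := by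
      rw [natDegree_X_mul hm.ne_zero, hd]
    have hlt : (C (starRingEnd ℂ (a n)) * reversedPoly n (opuc a n)).degree <
        (X * opuc a n).degree := by
      rw [degree_eq_natDegree hX.ne_zero, hXd]
      refine (degree_le_natDegree.trans ?_).trans_lt
        (Nat.cast_lt.2 (Nat.lt_succ_self n) : ((n : ℕ) : WithBot ℕ) < ((n + 1 : ℕ) : WithBot ℕ))
      exact_mod_cast (natDegree_C_mul_le _ _).trans (natDegree_reversedPoly_le hd.le)
    refine ⟨hX.sub_of_left hlt, ?_⟩
    rw [opuc, natDegree_eq_of_degree_eq (degree_sub_eq_left_of_degree_lt hlt), hXd]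

theorem monic_opuc (a : ℕ → ℂ) (n : ℕ) : (opuc a n).Monic := (opuc_monic_and_natDegree a n).1

theorem natDegree_opuc (a : ℕ → ℂ) (n : ℕ) : (opuc a n).natDegree = n :=
  (opuc_monic_and_natDegree a n).2

theorem card_roots_opuc (a : ℕ → ℂ) (n : ℕ) : Multiset.card (opuc a n).roots = n := by
  rw [IsAlgClosed.card_roots_eq_natDegree, natDegree_opuc]

theorem map_reversedPoly_opuc (a : ℕ → ℂ) (n : ℕ) :
    (reversedPoly n (opuc a n)).map (starRingEnd ℂ) = (opuc a n).reflect n := by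
  rw [reversedPoly, ← reflect_map, Polynomial.map_map]
  congr 1
  ext i
  simp

/-- The Szegő recurrence for the reversed polynomials. -/
theorem reversedPoly_opuc_succ (a : ℕ → ℂ) (n : ℕ) :
    reversedPoly (n + 1) (opuc a (n + 1)) =
      reversedPoly n (opuc a n) - C (a n) * (X * opuc a n) := by
  have hd : ((opuc a n).map (starRingEnd ℂ)).natDegree ≤ n :=
    natDegree_map_le.trans (natDegree_opuc a n).le
  conv_lhs => rw [opuc, reversedPoly]
  rw [Polynomial.map_sub, Polynomial.map_mul, Polynomial.map_mul, map_X, map_C, reflect_sub,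
    reflect_succ_X_mul hd, map_reversedPoly_opuc, reflect_C_mul,
    reflect_succ (natDegree_reflect_le.trans (by simp [natDegree_opuc])), reflect_reflect]
  simp [reversedPoly]

/-- Outside the open unit disk `opuc a n` dominates its reversed polynomial and is nonzero. -/
theorem eval_opuc_ne_zero_and_norm_le {a : ℕ → ℂ} (ha : ∀ n, ‖a n‖ < 1) {z : ℂ}
    (hz : 1 ≤ ‖z‖) (n : ℕ) :
    (opuc a n).eval z ≠ 0 ∧ ‖(reversedPoly n (opuc a n)).eval z‖ ≤ ‖(opuc a n).eval z‖ := by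
  induction n with
  | zero => simp [opuc, reversedPoly]
  | succ n ih =>
    obtain ⟨h0, hle⟩ := ih
    rw [reversedPoly_opuc_succ, opuc]
    simp only [eval_sub, eval_mul, eval_X, eval_C]
    set p := (opuc a n).eval z
    set q := (reversedPoly n (opuc a n)).eval z
    have hp : 0 < ‖p‖ := norm_pos_iff.2 h0
    have hzp : ‖q‖ ≤ ‖z * p‖ := by
      rw [norm_mul]; nlinarith
    have hzp0 : 0 < ‖z * p‖ := by rw [norm_mul]; positivity
    -- The Szegő step preserves the indefinite form `|x|² - |y|²` up to the factor `1 - |a n|²`.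
    have key : ‖z * p - starRingEnd ℂ (a n) * q‖ ^ 2 - ‖q - a n * (z * p)‖ ^ 2 =
        (1 - ‖a n‖ ^ 2) * (‖z * p‖ ^ 2 - ‖q‖ ^ 2) := by
      simp only [← Complex.normSq_eq_norm_sq, Complex.normSq_apply, Complex.sub_re,
        Complex.sub_im, Complex.mul_re, Complex.mul_im, Complex.conj_re, Complex.conj_im]
      ring
    have hpos : 0 ≤ (1 - ‖a n‖ ^ 2) * (‖z * p‖ ^ 2 - ‖q‖ ^ 2) := by
      apply mul_nonneg
      · nlinarith [ha n, norm_nonneg (a n)]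
      · nlinarith [norm_nonneg q]
    constructor
    · intro h
      have h2 : ‖z * p‖ = ‖a n‖ * ‖q‖ := by
        rw [sub_eq_zero.1 h, norm_mul, RCLike.norm_conj]
      nlinarith [ha n, norm_nonneg (a n), norm_nonneg q]
    · exact abs_le_of_sq_le_sq' (by linarith) (norm_nonneg _) |>.2

theorem norm_lt_one_of_mem_roots_opuc {a : ℕ → ℂ} (ha : ∀ n, ‖a n‖ < 1) {n : ℕ} {z : ℂ}
    (hz : z ∈ (opuc a n).roots) : ‖z‖ < 1 := by
  by_contra! h
  exact (eval_opuc_ne_zero_and_norm_le ha h n).1 (isRoot_of_mem_roots hz)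

/-- By Vieta, the product is the modulus of the constant coefficient. The recurrence gives that
coefficient as `-conj (a n)`, because the reversal of a monic polynomial has constant term 1. -/
theorem prod_norm_roots_opuc_succ (a : ℕ → ℂ) (n : ℕ) :
    ((opuc a (n + 1)).roots.map fun z => ‖z‖).prod = ‖a n‖ := by
  have h1 : ‖(opuc a (n + 1)).coeff 0‖ = ‖a n‖ := by
    have hc : (reversedPoly n (opuc a n)).coeff 0 = 1 := by
      rw [reversedPoly, coeff_reflect, revAt_zero, coeff_map]
      have := monic_opuc a n
      rw [Monic, leadingCoeff, natDegree_opuc] at this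
      simp [this]
    rw [opuc, coeff_sub, coeff_C_mul, hc]
    simp
  have hs : (opuc a (n + 1)).Splits := IsAlgClosed.splits _
  rw [← h1, hs.coeff_zero_eq_prod_roots_of_monic (monic_opuc a (n + 1))]
  rw [norm_mul, norm_pow, norm_neg, norm_one, one_pow, one_mul]
  exact ((normHom : ℂ →*₀ ℝ).toMonoidHom.map_multiset_prod _).symm

/-! ### Local factors at infinity -/

/-- The polynomial `z^n Φ_n(1/z) = ∏ (1 - zⱼ z)` as a power series. -/
noncomputable def opucRev (a : ℕ → ℂ) (n : ℕ) : PowerSeries ℂ :=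
  ((opuc a n).reflect n : ℂ[X])

/-- The quotient `Φ_n^* / Φ_n` expanded at infinity, as a power series in `1/z`. -/
noncomputable def opucQuot (a : ℕ → ℂ) (n : ℕ) : PowerSeries ℂ :=
  ((opuc a n).map (starRingEnd ℂ) : ℂ[X]) * (opucRev a n)⁻¹

/-- The ratio `Φ_{n+1}(z) / (z Φ_n(z))` expanded at infinity, as a power series in `1/z`. -/
noncomputable def opucFactor (a : ℕ → ℂ) (n : ℕ) : PowerSeries ℂ :=
  1 - PowerSeries.C (starRingEnd ℂ (a n)) * (PowerSeries.X * opucQuot a n)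

theorem constantCoeff_opucRev (a : ℕ → ℂ) (n : ℕ) :
    PowerSeries.constantCoeff (opucRev a n) = 1 := by
  have := monic_opuc a n
  rw [Monic, leadingCoeff, natDegree_opuc] at this
  rw [opucRev, ← PowerSeries.coeff_zero_eq_constantCoeff_apply, Polynomial.coeff_coe,
    coeff_reflect, revAt_zero, this]

theorem constantCoeff_opucFactor (a : ℕ → ℂ) (n : ℕ) :
    PowerSeries.constantCoeff (opucFactor a n) = 1 := by
  simp [opucFactor]

theorem opucQuot_mul_opucRev (a : ℕ → ℂ) (n : ℕ) :
    opucQuot a n * opucRev a n = ((opuc a n).map (starRingEnd ℂ) : ℂ[X]) := by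
  rw [opucQuot, mul_assoc, PowerSeries.inv_mul_cancel _ (by simp [constantCoeff_opucRev]),
    mul_one]

theorem opucRev_succ (a : ℕ → ℂ) (n : ℕ) :
    opucRev a (n + 1) = opucRev a n * opucFactor a n := by
  have hr : reflect (n + 1) (reversedPoly n (opuc a n)) =
      X * (opuc a n).map (starRingEnd ℂ) := by
    rw [reflect_succ (natDegree_reversedPoly_le (natDegree_opuc a n).le), reversedPoly,
      reflect_reflect]
  rw [opucRev, opuc, reflect_sub, reflect_succ_X_mul (natDegree_opuc a n).le, reflect_C_mul, hr,
    opucFactor]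
  have := opucQuot_mul_opucRev a n
  push_cast
  rw [← this, ← opucRev]
  ring

/-- Dividing the recurrence for the reversed polynomials by the one for `Φ_n` gives a Möbius
recursion of Schur type for their quotient. -/
theorem opucQuot_succ_mul_opucFactor (a : ℕ → ℂ) (n : ℕ) :
    opucQuot a (n + 1) * opucFactor a n =
      PowerSeries.X * opucQuot a n - PowerSeries.C (a n) := by
  have h1 := opucQuot_mul_opucRev a (n + 1)
  rw [opucRev_succ, opuc, Polynomial.map_sub, Polynomial.map_mul, Polynomial.map_mul, map_X,
    map_C, map_reversedPoly_opuc, Complex.conj_conj] at h1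
  push_cast at h1
  rw [← opucQuot_mul_opucRev, ← opucRev] at h1
  have hne : opucRev a n ≠ 0 := by
    intro h
    simpa [h] using constantCoeff_opucRev a n
  apply mul_right_cancel₀ hne
  linear_combination h1

theorem opucQuot_zero (a : ℕ → ℂ) : opucQuot a 0 = 1 := by
  have := opucQuot_mul_opucRev a 0
  simpa [opucRev, opuc] using this

theorem coeff_zero_opucQuot_succ (a : ℕ → ℂ) (n : ℕ) :
    PowerSeries.coeff 0 (opucQuot a (n + 1)) = -a n := by
  have := congrArg PowerSeries.constantCoeff (opucQuot_succ_mul_opucFactor a n)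
  simpa [constantCoeff_opucFactor] using this

/-- Division-free form of the Möbius recursion. The right side involves only coefficients of order
at most `m`, so limits and bounds follow by strong induction on the order. -/
theorem coeff_succ_opucQuot_succ (a : ℕ → ℂ) (n m : ℕ) :
    PowerSeries.coeff (m + 1) (opucQuot a (n + 1)) =
      PowerSeries.coeff m (opucQuot a n) + starRingEnd ℂ (a n) *
        ∑ p ∈ Finset.HasAntidiagonal.antidiagonal m, PowerSeries.coeff p.1 (opucQuot a n) *
          PowerSeries.coeff p.2 (opucQuot a (n + 1)) := by
  have h : opucQuot a (n + 1) = PowerSeries.X * opucQuot a n - PowerSeries.C (a n) +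
      PowerSeries.C (starRingEnd ℂ (a n)) *
        (PowerSeries.X * (opucQuot a n * opucQuot a (n + 1))) := by
    rw [← opucQuot_succ_mul_opucFactor, opucFactor]
    ring
  have := congrArg (PowerSeries.coeff (m + 1)) h
  rw [map_add, map_sub, PowerSeries.coeff_C_mul, PowerSeries.coeff_succ_X_mul,
    PowerSeries.coeff_succ_X_mul, PowerSeries.coeff_mul] at this
  simpa [PowerSeries.coeff_C] using this

theorem coeff_succ_opucFactor (a : ℕ → ℂ) (n m : ℕ) :
    PowerSeries.coeff (m + 1) (opucFactor a n) =
      -(starRingEnd ℂ (a n) * PowerSeries.coeff m (opucQuot a n)) := by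
  rw [opucFactor, map_sub, PowerSeries.coeff_C_mul, PowerSeries.coeff_succ_X_mul]
  simp [PowerSeries.coeff_one]

theorem opucRev_eq_prod_roots (a : ℕ → ℂ) (n : ℕ) :
    opucRev a n =
      ((opuc a n).roots.map fun z => 1 - PowerSeries.C z * PowerSeries.X).prod := by
  have hs : (opuc a n).Splits := IsAlgClosed.splits _
  have key : ∀ s : Multiset ℂ, (((s.map fun z => X - C z).prod.reverse : ℂ[X]) : PowerSeries ℂ) =
      (s.map fun z => 1 - PowerSeries.C z * PowerSeries.X).prod := by
    intro s
    induction s using Multiset.induction_on with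
    | empty => simp [reverse]
    | cons z s ih =>
      rw [Multiset.map_cons, Multiset.prod_cons, reverse_mul_of_domain, Multiset.map_cons,
        Multiset.prod_cons, ← ih, Polynomial.coe_mul]
      congr 1
      rw [reverse, natDegree_X_sub_C, reflect_sub, reflect_one_X, reflect_C]
      simp
  rw [← key, ← hs.eq_prod_roots_of_monic (monic_opuc a n), reverse, natDegree_opuc, opucRev]

/-- The power sums of the zeros as sums of the coefficients of the local factors. -/
theorem sum_roots_opuc_pow (a : ℕ → ℂ) (n m : ℕ) :
    ((opuc a n).roots.map fun z => z ^ (m + 1)).sum =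
      ∑ k ∈ Finset.range n, PowerSeries.coeff (m + 1) (negLogDeriv (opucFactor a k)) := by
  rw [← coeff_negLogDeriv_prod, ← opucRev_eq_prod_roots]
  induction n with
  | zero => simp [opucRev, opuc]
  | succ n ih =>
    rw [Finset.sum_range_succ, ← ih, opucRev_succ, negLogDeriv_mul, map_add]
    · simp [constantCoeff_opucRev]
    · simp [constantCoeff_opucFactor]

/-! ### The fixed point for a constant Verblunsky coefficient -/

/-- The coefficients of the solution `b` of `b = X b - α + conj α X b ^ 2`. -/
noncomputable def fixedQuotCoeff (α : ℂ) : ℕ → ℂ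
  | 0 => -α
  | m + 1 => fixedQuotCoeff α m + starRingEnd ℂ α *
      ∑ i : Fin (m + 1), fixedQuotCoeff α i * fixedQuotCoeff α (m - i)

theorem fixedQuotCoeff_succ (α : ℂ) (m : ℕ) :
    fixedQuotCoeff α (m + 1) = fixedQuotCoeff α m + starRingEnd ℂ α *
      ∑ p ∈ Finset.HasAntidiagonal.antidiagonal m,
        fixedQuotCoeff α p.1 * fixedQuotCoeff α p.2 := by
  rw [fixedQuotCoeff, Finset.Nat.sum_antidiagonal_eq_sum_range_succ
    (fun i j => fixedQuotCoeff α i * fixedQuotCoeff α j), Finset.sum_range]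

/-- The limit of the factors `opucFactor` when the Verblunsky coefficients tend to `α`. -/
noncomputable def fixedFactor (α : ℂ) : PowerSeries ℂ :=
  1 - PowerSeries.C (starRingEnd ℂ α) *
    (PowerSeries.X * PowerSeries.mk (fixedQuotCoeff α))

theorem constantCoeff_fixedFactor (α : ℂ) : PowerSeries.constantCoeff (fixedFactor α) = 1 := by
  simp [fixedFactor]

theorem coeff_succ_fixedFactor (α : ℂ) (m : ℕ) :
    PowerSeries.coeff (m + 1) (fixedFactor α) =
      -(starRingEnd ℂ α * fixedQuotCoeff α m) := by
  rw [fixedFactor, map_sub, PowerSeries.coeff_C_mul, PowerSeries.coeff_succ_X_mul]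
  simp [PowerSeries.coeff_one]

/-- The quadratic equation of the limiting factor. -/
theorem fixedFactor_mul_self (α : ℂ) :
    fixedFactor α * (fixedFactor α - (1 + PowerSeries.X)) =
      -(PowerSeries.C (1 - (‖α‖ : ℂ) ^ 2) * PowerSeries.X) := by
  set b := PowerSeries.mk (fixedQuotCoeff α) with hb
  -- The recursion for the coefficients is this fixed point equation; substituting `conj α X b = 1 -
  -- h` turns it into the quadratic for the factor `h`.
  have hfix : b = PowerSeries.X * b - PowerSeries.C α +
      PowerSeries.C (starRingEnd ℂ α) * (PowerSeries.X * (b * b)) := by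
    ext m
    rw [map_add, map_sub, PowerSeries.coeff_C_mul]
    cases m with
    | zero => simp [hb, fixedQuotCoeff]
    | succ m =>
      rw [PowerSeries.coeff_succ_X_mul, PowerSeries.coeff_succ_X_mul, PowerSeries.coeff_mul]
      simp [hb, fixedQuotCoeff_succ]
  have hC : PowerSeries.C (1 - (‖α‖ : ℂ) ^ 2) =
      1 - PowerSeries.C (starRingEnd ℂ α) * PowerSeries.C α := by
    rw [← map_mul, ← map_one (PowerSeries.C (R := ℂ)), ← map_sub, Complex.conj_mul']
  rw [hC, fixedFactor, ← hb]
  linear_combination -(PowerSeries.C (starRingEnd ℂ α) * PowerSeries.X) * hfix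

/-! ### Local limits and uniform bounds -/

/-- The shift moves the ratio by `1/N → 0`. Hence neighbouring indices share their limits, which the
recursion between `n` and `n + 1` requires. -/
theorem RatioTendsto.succ {Y : Type*} [TopologicalSpace Y] {x : ℕ → ℕ → Y} {s : ℝ} {l : Y}
    (h : RatioTendsto x s l) : RatioTendsto (fun n N => x (n + 1) N) s l := by
  intro n N hn hN hs
  refine h (fun j => n j + 1) N ((tendsto_add_atTop_nat 1).comp hn) hN ?_
  have h0 : Tendsto (fun j => 1 / (N j : ℝ)) atTop (𝓝 0) :=
    tendsto_one_div_atTop_nhds_zero_nat.comp hN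
  simpa [add_div] using hs.add h0

theorem RatioTendsto.of_succ {Y : Type*} [TopologicalSpace Y] {x : ℕ → ℕ → Y} {s : ℝ} {l : Y}
    (h : RatioTendsto (fun n N => x (n + 1) N) s l) : RatioTendsto x s l := by
  intro n N hn hN hs
  have h0 : Tendsto (fun j => 1 / (N j : ℝ)) atTop (𝓝 0) :=
    tendsto_one_div_atTop_nhds_zero_nat.comp hN
  have hpos : ∀ᶠ j in atTop, 1 ≤ n j := hn.eventually_ge_atTop 1
  have := h (fun j => n j - 1) N ((tendsto_sub_atTop_nat 1).comp hn) hN ?_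
  · refine this.congr' ?_
    filter_upwards [hpos] with j hj
    simp [Nat.sub_add_cancel hj]
  · have h2 := hs.sub h0
    rw [sub_zero] at h2
    refine h2.congr' ?_
    filter_upwards [hpos] with j hj
    rw [Nat.cast_sub hj, Nat.cast_one, sub_div]

/-- The recursion for the coefficients passes to the limit term by term and becomes the recursion
defining `fixedQuotCoeff`. The initial value at `n = 0` is forgotten, since order zero already
equals `-a (n - 1)` for `n ≥ 1`. -/
theorem ratioTendsto_coeff_opucQuot {a : ℕ → ℕ → ℂ} {s : ℝ} {α : ℂ} (h : RatioTendsto a s α)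
    (m : ℕ) :
    RatioTendsto (fun n N => PowerSeries.coeff m (opucQuot (fun k => a k N) n)) s
      (fixedQuotCoeff α m) := by
  induction m using Nat.strong_induction_on with
  | _ m ih =>
    apply RatioTendsto.of_succ
    cases m with
    | zero =>
      simp only [coeff_zero_opucQuot_succ]
      rw [fixedQuotCoeff]
      exact fun n N hn hN hs => (h n N hn hN hs).neg
    | succ m =>
      simp only [coeff_succ_opucQuot_succ]
      rw [fixedQuotCoeff_succ]
      intro n N hn hN hs
      refine (ih m (Nat.lt_succ_self m) n N hn hN hs).add
        (((Complex.continuous_conj.tendsto _).comp (h n N hn hN hs)).mul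
          (tendsto_finsetSum _ fun p hp => ?_))
      have hp' := Finset.HasAntidiagonal.mem_antidiagonal.1 hp
      exact (ih p.1 (by omega) n N hn hN hs).mul ((ih p.2 (by omega)).succ n N hn hN hs)

/-- For constant term 1, each coefficient of the logarithmic derivative is a fixed polynomial in
finitely many coefficients of the series. -/
theorem ratioTendsto_coeff_negLogDeriv {f : ℕ → ℕ → PowerSeries ℂ} {g : PowerSeries ℂ} {s : ℝ}
    (hf : ∀ n N, PowerSeries.constantCoeff (f n N) = 1) (hg : PowerSeries.constantCoeff g = 1)
    (h : ∀ m, RatioTendsto (fun n N => PowerSeries.coeff m (f n N)) s (PowerSeries.coeff m g))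
    (m : ℕ) :
    RatioTendsto (fun n N => PowerSeries.coeff m (negLogDeriv (f n N))) s
      (PowerSeries.coeff m (negLogDeriv g)) := by
  induction m using Nat.strong_induction_on with
  | _ m ih =>
    intro n N hn hN hs
    cases m with
    | zero => simp only [coeff_zero_negLogDeriv, tendsto_const_nhds]
    | succ m =>
      simp only [coeff_negLogDeriv_succ (hf _ _), coeff_negLogDeriv_succ hg]
      refine ((h (m + 1) n N hn hN hs).const_mul _).neg.sub (tendsto_finsetSum _ fun p hp => ?_)
      have hp' := Finset.HasAntidiagonal.mem_antidiagonal.1 hp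
      exact (ih p.1 (by omega) n N hn hN hs).mul (h _ n N hn hN hs)

theorem ratioTendsto_coeff_negLogDeriv_opucFactor {a : ℕ → ℕ → ℂ} {s : ℝ} {α : ℂ}
    (h : RatioTendsto a s α) (m : ℕ) :
    RatioTendsto (fun n N => PowerSeries.coeff m (negLogDeriv (opucFactor (fun k => a k N) n))) s
      (PowerSeries.coeff m (negLogDeriv (fixedFactor α))) := by
  refine ratioTendsto_coeff_negLogDeriv (fun n N => constantCoeff_opucFactor _ _)
    (constantCoeff_fixedFactor α) (fun k n N hn hN hs => ?_) m
  cases k with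
  | zero =>
    simp [constantCoeff_opucFactor, constantCoeff_fixedFactor]
  | succ k =>
    simp only [coeff_succ_opucFactor, coeff_succ_fixedFactor]
    exact (((Complex.continuous_conj.tendsto _).comp (h n N hn hN hs)).mul
      (ratioTendsto_coeff_opucQuot h k n N hn hN hs)).neg

theorem exists_bound_coeff_opucQuot (m : ℕ) :
    ∃ B : ℝ, ∀ a : ℕ → ℂ, (∀ n, ‖a n‖ < 1) → ∀ n,
      ‖PowerSeries.coeff m (opucQuot a n)‖ ≤ B := by
  induction m using Nat.strong_induction_on with
  | _ m ih =>
    choose! B hB using ih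
    cases m with
    | zero =>
      refine ⟨1, fun a ha n => ?_⟩
      cases n with
      | zero => simp [opucQuot_zero]
      | succ n => rw [coeff_zero_opucQuot_succ, norm_neg]; exact (ha n).le
    | succ m =>
      refine ⟨|B m| + ∑ p ∈ Finset.HasAntidiagonal.antidiagonal m, |B p.1| * |B p.2|,
        fun a ha n => ?_⟩
      cases n with
      | zero =>
        rw [opucQuot_zero, PowerSeries.coeff_one]
        simp only [Nat.add_eq_zero_iff, one_ne_zero, and_false, if_false, norm_zero]
        positivity
      | succ n =>
        rw [coeff_succ_opucQuot_succ]
        refine (norm_add_le _ _).trans (add_le_add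
          ((hB m (Nat.lt_succ_self m) a ha n).trans (le_abs_self _)) ?_)
        rw [norm_mul, RCLike.norm_conj]
        refine (mul_le_of_le_one_left (norm_nonneg _) (ha n).le).trans ?_
        refine norm_sum_le_of_le _ fun p hp => ?_
        have hp' := Finset.HasAntidiagonal.mem_antidiagonal.1 hp
        rw [norm_mul]
        exact mul_le_mul ((hB p.1 (by omega) a ha n).trans (le_abs_self _))
          ((hB p.2 (by omega) a ha (n + 1)).trans (le_abs_self _)) (norm_nonneg _) (abs_nonneg _)

theorem exists_bound_coeff_negLogDeriv {ι : Type*} {f : ι → PowerSeries ℂ}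
    (hf : ∀ i, PowerSeries.constantCoeff (f i) = 1)
    (h : ∀ m, ∃ B : ℝ, ∀ i, ‖PowerSeries.coeff m (f i)‖ ≤ B) (m : ℕ) :
    ∃ B : ℝ, ∀ i, ‖PowerSeries.coeff m (negLogDeriv (f i))‖ ≤ B := by
  choose D hD using h
  induction m using Nat.strong_induction_on with
  | _ m ih =>
    choose! B hB using ih
    cases m with
    | zero => exact ⟨0, fun i => by rw [coeff_zero_negLogDeriv, norm_zero]⟩
    | succ m =>
      refine ⟨(m + 1) * D (m + 1) +
        ∑ p ∈ Finset.HasAntidiagonal.antidiagonal m, |B p.1| * |D (p.2 + 1)|, fun i => ?_⟩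
      rw [coeff_negLogDeriv_succ (hf i)]
      refine (norm_sub_le _ _).trans (add_le_add ?_ (norm_sum_le_of_le _ fun p hp => ?_))
      · rw [norm_neg, norm_mul]
        have : ‖(m : ℂ) + 1‖ = m + 1 := by
          exact_mod_cast Complex.norm_natCast (m + 1)
        rw [this]
        exact mul_le_mul_of_nonneg_left (hD _ i) (by positivity)
      · have hp' := Finset.HasAntidiagonal.mem_antidiagonal.1 hp
        rw [norm_mul]
        exact mul_le_mul ((hB p.1 (by omega) i).trans (le_abs_self _))
          ((hD _ i).trans (le_abs_self _)) (norm_nonneg _) (abs_nonneg _)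

/-- Supplies the constant dominating function when the mean over `k` is passed to the limit. -/
theorem exists_bound_coeff_negLogDeriv_opucFactor {a : ℕ → ℕ → ℂ} (ha : ∀ n N, ‖a n N‖ < 1)
    (m : ℕ) :
    ∃ B : ℝ, ∀ n N,
      ‖PowerSeries.coeff m (negLogDeriv (opucFactor (fun k => a k N) n))‖ ≤ B := by
  have h : ∀ k, ∃ B : ℝ, ∀ p : ℕ × ℕ,
      ‖PowerSeries.coeff k (opucFactor (fun k => a k p.2) p.1)‖ ≤ B := by
    intro k
    cases k with
    | zero => exact ⟨1, fun p => by simp [constantCoeff_opucFactor]⟩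
    | succ k =>
      obtain ⟨B, hB⟩ := exists_bound_coeff_opucQuot k
      refine ⟨B, fun p => ?_⟩
      rw [coeff_succ_opucFactor, norm_neg, norm_mul, RCLike.norm_conj]
      exact (mul_le_of_le_one_left (norm_nonneg _) (ha _ _).le).trans
        (hB _ (fun n => ha n p.2) p.1)
  obtain ⟨B, hB⟩ := exists_bound_coeff_negLogDeriv
    (fun p : ℕ × ℕ => constantCoeff_opucFactor (fun k => a k p.2) p.1) h m
  exact ⟨B, fun n N => hB (n, N)⟩

/-! ### From local limits to averages -/

theorem integral_floor_eq_sum (x : ℕ → ℂ) (n : ℕ) :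
    ∫ v in (0 : ℝ)..n, x ⌊v⌋₊ = ∑ k ∈ Finset.range n, x k := by
  have hae : ∀ k : ℕ, ∀ v ∈ Set.Ioo (k : ℝ) ((k + 1 : ℕ) : ℝ), x k = x ⌊v⌋₊ := by
    intro k v hv
    have : ⌊v⌋₊ = k := by
      rw [Nat.floor_eq_iff ((Nat.cast_nonneg k).trans hv.1.le)]
      exact ⟨hv.1.le, by exact_mod_cast hv.2⟩
    rw [this]
  have hle : ∀ k : ℕ, (k : ℝ) ≤ ((k + 1 : ℕ) : ℝ) := fun k => by simp
  have hint : ∀ k < n, IntervalIntegrable (fun v : ℝ => x ⌊v⌋₊) volume (k : ℝ)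
      ((k + 1 : ℕ) : ℝ) := by
    intro k _
    refine (intervalIntegrable_const (c := x k)).congr_ae ?_
    rw [Set.uIoc_of_le (hle k), ← restrict_Ioo_eq_restrict_Ioc]
    exact (ae_restrict_iff' measurableSet_Ioo).2 (Eventually.of_forall (hae k))
  have := intervalIntegral.sum_integral_adjacent_intervals (a := fun k : ℕ => (k : ℝ)) hint
  rw [Nat.cast_zero] at this
  rw [← this]
  refine Finset.sum_congr rfl fun k _ => ?_
  rw [intervalIntegral.integral_of_le (hle k), integral_Ioc_eq_integral_Ioo,
    ← setIntegral_congr_fun measurableSet_Ioo (hae k)]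
  simp

/-- Averages of a bounded double sequence with local limits `y s` converge to the mean of `y`. -/
theorem ratioTendsto_average {x : ℕ → ℕ → ℂ} {y : ℝ → ℂ} {t B : ℝ} (ht : 0 < t)
    (hB : ∀ n N, ‖x n N‖ ≤ B)
    (h : ∀ᵐ s ∂(volume.restrict (Set.Icc 0 t)), RatioTendsto x s (y s)) :
    RatioTendsto (fun n N => (n : ℂ)⁻¹ * ∑ k ∈ Finset.range n, x k N) t
      ((t : ℂ)⁻¹ * ∫ s in Set.Icc 0 t, y s) := by
  intro n N hn hN hs
  have hnR : Tendsto (fun j => (n j : ℝ)) atTop atTop := tendsto_natCast_atTop_atTop.comp hn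
  have hpos : ∀ᶠ j in atTop, 1 ≤ n j := hn.eventually_ge_atTop 1
  have hlhs : ∀ j, 1 ≤ n j → ∫ u in (0 : ℝ)..1, x ⌊(n j : ℝ) * u⌋₊ (N j) =
      (n j : ℂ)⁻¹ * ∑ k ∈ Finset.range (n j), x k (N j) := by
    intro j hj
    have hne : (n j : ℝ) ≠ 0 := by positivity
    rw [intervalIntegral.integral_comp_mul_left (fun v : ℝ => x ⌊v⌋₊ (N j)) hne]
    rw [mul_zero, mul_one, integral_floor_eq_sum (fun k => x k (N j))]
    simp
  have hrhs : ∫ u in (0 : ℝ)..1, y (t * u) = (t : ℂ)⁻¹ * ∫ s in Set.Icc 0 t, y s := by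
    rw [intervalIntegral.integral_comp_mul_left y ht.ne', mul_zero, mul_one,
      intervalIntegral.integral_of_le ht.le, integral_Icc_eq_integral_Ioc]
    simp
  rw [← hrhs]
  refine Tendsto.congr' (hpos.mono hlhs) ?_
  -- Both sides are now integrals over `u ∈ [0, 1]`, with `k = ⌊n u⌋` and `s = t u`.
  refine intervalIntegral.tendsto_integral_filter_of_dominated_convergence (fun _ => B) ?_ ?_ ?_ ?_
  · refine Eventually.of_forall fun j => Measurable.aestronglyMeasurable ?_
    exact (measurable_from_nat (f := fun k => x k (N j))).comp
      (Nat.measurable_floor.comp (measurable_const_mul _))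
  · exact Eventually.of_forall fun j => Eventually.of_forall fun u _ => hB _ _
  · exact intervalIntegrable_const
  · have h1 := (ae_restrict_iff' measurableSet_Icc).1 h
    -- The exceptional null set of `s` stays null under the scaling `s = t u`.
    have h2 : ∀ᵐ u : ℝ, t * u ∈ Set.Icc 0 t → RatioTendsto x (t * u) (y (t * u)) := by
      rw [ae_iff] at h1 ⊢
      have := Real.volume_preimage_mul_left ht.ne'
        {s | ¬(s ∈ Set.Icc 0 t → RatioTendsto x s (y s))}
      rw [h1, mul_zero] at this
      exact this
    filter_upwards [h2] with u hu hu01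
    rw [Set.uIoc_of_le zero_le_one] at hu01
    have hgood := hu ⟨mul_nonneg ht.le hu01.1.le, mul_le_of_le_one_right ht.le hu01.2⟩
    refine hgood (fun j => ⌊(n j : ℝ) * u⌋₊) N ?_ hN ?_
    · exact tendsto_nat_floor_atTop.comp (hnR.atTop_mul_const hu01.1)
    -- `⌊n u⌋ / N = (n / N) (⌊u n⌋ / n) → t u`.
    · have h3 := (tendsto_nat_floor_mul_div_atTop (R := ℝ) hu01.1.le).comp hnR
      have h4 := hs.mul h3
      refine h4.congr' ?_
      filter_upwards [hpos] with j hj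
      have hne : (n j : ℝ) ≠ 0 := by positivity
      simp only [Function.comp]
      rw [mul_comm u]
      field_simp

/-! ### Weak convergence from holomorphic moments -/

/-- A family of probability measures on the closed disk concentrating near the circle is weakly
convergent as soon as its moments converge. -/
theorem tendsto_integral_of_tendsto_moments {ι : Type*} {l : Filter ι} {μ : ι → Measure ℂ}
    {ν : Measure ℂ} [∀ i, IsProbabilityMeasure (μ i)] [IsProbabilityMeasure ν]
    (hμ : ∀ i, ∀ᵐ z ∂(μ i), ‖z‖ ≤ 1) (hν : ∀ᵐ z ∂ν, ‖z‖ = 1)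
    (hr : Tendsto (fun i => ∫ z, (1 - ‖z‖) ∂(μ i)) l (𝓝 0))
    (hm : ∀ m : ℕ, Tendsto (fun i => ∫ z, z ^ m ∂(μ i)) l (𝓝 (∫ z, z ^ m ∂ν)))
    (f : ℂ →ᵇ ℝ) : Tendsto (fun i => ∫ z, f z ∂(μ i)) l (𝓝 (∫ z, f z ∂ν)) := by
  have hν' : ∀ᵐ z ∂ν, ‖z‖ ≤ 1 := hν.mono fun z hz => hz.le
  -- integrability of continuous functions against measures on the closed disk
  have hI : ∀ (ρ : Measure ℂ) [IsProbabilityMeasure ρ], (∀ᵐ z ∂ρ, ‖z‖ ≤ 1) →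
      ∀ g : ℂ → ℂ, Continuous g → Integrable g ρ := by
    intro ρ _ hρ g hg
    obtain ⟨C, hC⟩ := (isCompact_closedBall (0 : ℂ) 1).exists_bound_of_continuousOn hg.continuousOn
    exact Integrable.of_bound hg.aestronglyMeasurable C
      (hρ.mono fun z hz => hC z (by simpa using hz))
  -- By Bernoulli's inequality, replacing `|z|^(2q)` by 1 on the disk costs at most `2q (1 - |z|)`,
  -- whose mean tends to zero.
  have hpow : ∀ (p q : ℕ) (z : ℂ), ‖z‖ ≤ 1 →
      ‖z ^ p * (z ^ q * (starRingEnd ℂ z) ^ q) - z ^ p‖ ≤ 2 * q * (1 - ‖z‖) := by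
    intro p q z hz
    have h1 : z ^ p * (z ^ q * (starRingEnd ℂ z) ^ q) - z ^ p =
        z ^ p * (((‖z‖ ^ (2 * q) - 1 : ℝ) : ℂ)) := by
      rw [← mul_pow, Complex.mul_conj']
      push_cast
      rw [← pow_mul]
      ring
    rw [h1, norm_mul, norm_pow, Complex.norm_real, Real.norm_eq_abs, abs_sub_comm]
    have h2 : 1 + ((2 * q : ℕ) : ℝ) * (‖z‖ - 1) ≤ ‖z‖ ^ (2 * q) := by
      have := one_add_mul_le_pow (a := ‖z‖ - 1) (by linarith [norm_nonneg z]) (2 * q)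
      simpa using this
    push_cast at h2
    rw [abs_of_nonneg (by linarith [pow_le_one₀ (n := 2 * q) (norm_nonneg z) hz])]
    refine (mul_le_of_le_one_left ?_ (pow_le_one₀ (norm_nonneg z) hz)).trans (by linarith)
    linarith [pow_le_one₀ (n := 2 * q) (norm_nonneg z) hz]
  have hcont : ∀ p q : ℕ, Continuous fun z : ℂ => z ^ p * (z ^ q * (starRingEnd ℂ z) ^ q) :=
    fun p q => by fun_prop
  -- monomials `z ^ p |z| ^ (2 q)`
  have hA : ∀ p q : ℕ, Tendsto (fun i => ∫ z, z ^ p * (z ^ q * (starRingEnd ℂ z) ^ q) ∂(μ i)) l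
      (𝓝 (∫ z, z ^ p * (z ^ q * (starRingEnd ℂ z) ^ q) ∂ν)) := by
    intro p q
    have hνe : ∫ z, z ^ p * (z ^ q * (starRingEnd ℂ z) ^ q) ∂ν = ∫ z, z ^ p ∂ν := by
      refine integral_congr_ae (hν.mono fun z hz => ?_)
      have := hpow p q z hz.le
      rw [hz, sub_self, mul_zero] at this
      exact sub_eq_zero.1 (norm_le_zero_iff.1 this)
    rw [hνe]
    have hdiff : Tendsto (fun i => ∫ z, z ^ p * (z ^ q * (starRingEnd ℂ z) ^ q) ∂(μ i) -
        ∫ z, z ^ p ∂(μ i)) l (𝓝 0) := by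
      refine squeeze_zero_norm (a := fun i => 2 * q * ∫ z, (1 - ‖z‖) ∂(μ i)) (fun i => ?_)
        (by simpa using hr.const_mul (2 * q : ℝ))
      rw [← integral_sub (hI _ (hμ i) _ (hcont p q)) (hI _ (hμ i) _ (by fun_prop)),
        ← integral_const_mul]
      refine norm_integral_le_of_norm_le ?_ ((hμ i).mono fun z hz => hpow p q z hz)
      refine Integrable.const_mul ?_ _
      refine (integrable_const 1).sub ?_
      exact (hI _ (hμ i) _ continuous_id).norm
    simpa using hdiff.add (hm p)
  -- all monomials `z ^ p conj z ^ q`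
  have hM : ∀ p q : ℕ, Tendsto (fun i => ∫ z, z ^ p * (starRingEnd ℂ z) ^ q ∂(μ i)) l
      (𝓝 (∫ z, z ^ p * (starRingEnd ℂ z) ^ q ∂ν)) := by
    intro p q
    rcases le_total q p with h | h
    · obtain ⟨d, rfl⟩ := Nat.exists_eq_add_of_le h
      simpa only [pow_add, mul_assoc, mul_comm, mul_left_comm] using hA d q
    · obtain ⟨d, rfl⟩ := Nat.exists_eq_add_of_le h
      have h1 := (Complex.continuous_conj.tendsto _).comp (hA d p)
      have h2 : ∀ ρ : Measure ℂ, starRingEnd ℂ (∫ z, z ^ d * (z ^ p * (starRingEnd ℂ z) ^ p) ∂ρ) =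
          ∫ z, z ^ p * (starRingEnd ℂ z) ^ (p + d) ∂ρ := by
        intro ρ
        rw [← integral_conj]
        congr 1
        ext z
        simp only [map_mul, map_pow, Complex.conj_conj]
        ring
      simpa only [Function.comp_def, h2] using h1
  -- the class of functions on the disk for which the integrals converge
  let K : Set ℂ := Metric.closedBall 0 1
  have : CompactSpace K := isCompact_iff_compactSpace.1 (isCompact_closedBall 0 1)
  -- The star algebra generated by the coordinate is spanned by the monomials of `hM`; by
  -- Stone–Weierstrass it is dense in `C(K, ℂ)`. The extension `G` to the plane makes sense of the
  -- integrals.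
  have hspan : ∀ g ∈ (polynomialFunctions K).starClosure, ∃ G : ℂ → ℂ, Continuous G ∧
      (∀ z : K, G z = g z) ∧ Tendsto (fun i => ∫ z, G z ∂(μ i)) l (𝓝 (∫ z, G z ∂ν)) := by
    intro g hg
    rw [polynomialFunctions.starClosure_eq_adjoin_X, ← StarSubalgebra.mem_toSubalgebra,
      StarAlgebra.adjoin_toSubalgebra, ← Subalgebra.mem_toSubmodule, Algebra.adjoin_eq_span,
      Set.star_singleton, Set.singleton_union] at hg
    induction hg using Submodule.span_induction with
    | mem x hx =>
      obtain ⟨p, q, rfl⟩ := Submonoid.mem_closure_pair _ _ _ |>.1 hx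
      refine ⟨fun z => z ^ p * (starRingEnd ℂ z) ^ q, by fun_prop, fun z => ?_, hM p q⟩
      simp
    | zero => exact ⟨fun _ => 0, continuous_const, fun z => rfl, by simp [tendsto_const_nhds]⟩
    | add x y _ _ hx hy =>
      obtain ⟨G, hG, hGx, hGt⟩ := hx
      obtain ⟨H, hH, hHy, hHt⟩ := hy
      refine ⟨fun z => G z + H z, hG.add hH, fun z => by simp [hGx, hHy], ?_⟩
      simp only [integral_add (hI _ (hμ _) _ hG) (hI _ (hμ _) _ hH),
        integral_add (hI _ hν' _ hG) (hI _ hν' _ hH)]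
      exact hGt.add hHt
    | smul c x _ hx =>
      obtain ⟨G, hG, hGx, hGt⟩ := hx
      refine ⟨fun z => c * G z, continuous_const.mul hG, fun z => by simp [hGx], ?_⟩
      simp only [integral_const_mul]
      exact hGt.const_mul c
  have hfC : Continuous fun z => (f z : ℂ) := Complex.continuous_ofReal.comp f.continuous
  suffices hC : Tendsto (fun i => ∫ z, (f z : ℂ) ∂(μ i)) l (𝓝 (∫ z, (f z : ℂ) ∂ν)) by
    have := (Complex.continuous_re.tendsto _).comp hC
    simpa only [Function.comp_def, integral_complex_ofReal, Complex.ofReal_re] using this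
  rw [Metric.tendsto_nhds]
  intro ε hε
  have htop := polynomialFunctions.starClosure_topologicalClosure (𝕜 := ℂ) K
  have hmem : (⟨fun z : K => (f z : ℂ), hfC.comp continuous_subtype_val⟩ : C(K, ℂ)) ∈
      (polynomialFunctions K).starClosure.topologicalClosure := by rw [htop]; trivial
  rw [← SetLike.mem_coe, StarSubalgebra.topologicalClosure_coe, Metric.mem_closure_iff] at hmem
  obtain ⟨g, hg, hdist⟩ := hmem (ε / 4) (by positivity)
  obtain ⟨G, hG, hGg, hGt⟩ := hspan g hg
  have hclose : ∀ z : ℂ, ‖z‖ ≤ 1 → ‖(f z : ℂ) - G z‖ ≤ ε / 4 := by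
    intro z hz
    have := (ContinuousMap.dist_lt_iff (by positivity)).1 hdist ⟨z, by simpa [K] using hz⟩
    rw [← hGg, dist_eq_norm] at this
    exact this.le
  have hcl : ∀ (ρ : Measure ℂ) [IsProbabilityMeasure ρ], (∀ᵐ z ∂ρ, ‖z‖ ≤ 1) →
      ‖∫ z, (f z : ℂ) ∂ρ - ∫ z, G z ∂ρ‖ ≤ ε / 4 := by
    intro ρ _ hρ
    rw [← integral_sub (hI ρ hρ _ hfC) (hI ρ hρ _ hG)]
    simpa using norm_integral_le_of_norm_le_const (hρ.mono fun z hz => hclose z hz)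
  filter_upwards [Metric.tendsto_nhds.1 hGt (ε / 4) (by positivity)] with i hi
  have h1 := hcl (μ i) (hμ i)
  have h2 := hcl ν hν'
  rw [dist_eq_norm] at hi ⊢
  have : ∫ z, (f z : ℂ) ∂(μ i) - ∫ z, (f z : ℂ) ∂ν =
      (∫ z, (f z : ℂ) ∂(μ i) - ∫ z, G z ∂(μ i)) + (∫ z, G z ∂(μ i) - ∫ z, G z ∂ν) -
      (∫ z, (f z : ℂ) ∂ν - ∫ z, G z ∂ν) := by ring
  rw [this]
  refine (norm_sub_le _ _).trans_lt ?_
  have := norm_add_le (∫ z, (f z : ℂ) ∂(μ i) - ∫ z, G z ∂(μ i)) (∫ z, G z ∂(μ i) - ∫ z, G z ∂ν)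
  linarith

/-! ### Parametrisation of the arc measures -/

/-- The angle `θ` with `cos (θ / 2) = c * cos φ`. -/
noncomputable def arcParam (c φ : ℝ) : ℝ := 2 * Real.arccos (c * Real.cos φ)

theorem continuous_arcParam (c : ℝ) : Continuous (arcParam c) := by
  unfold arcParam
  exact continuous_const.mul (Real.continuous_arccos.comp (by fun_prop))

theorem arcParam_injOn {c : ℝ} (hc : 0 < c) (hc1 : c ≤ 1) :
    Set.InjOn (arcParam c) (Set.Ioo 0 Real.pi) := by
  have hmem : ∀ φ, c * Real.cos φ ∈ Set.Icc (-1 : ℝ) 1 := fun φ => by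
    constructor <;> nlinarith [Real.neg_one_le_cos φ, Real.cos_le_one φ]
  intro φ hφ ψ hψ h
  have h1 : Real.arccos (c * Real.cos φ) = Real.arccos (c * Real.cos ψ) := by
    unfold arcParam at h; linarith
  have h2 := Real.arccos_injOn (hmem φ) (hmem ψ) h1
  exact Real.injOn_cos (Set.Ioo_subset_Icc_self hφ) (Set.Ioo_subset_Icc_self hψ)
    (mul_left_cancel₀ hc.ne' h2)

theorem abs_cos_lt_one_of_mem_Ioo {φ : ℝ} (hφ : φ ∈ Set.Ioo 0 Real.pi) :
    -1 < Real.cos φ ∧ Real.cos φ < 1 := by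
  have h := Real.sin_pos_of_mem_Ioo hφ
  have := Real.sin_sq_add_cos_sq φ
  constructor <;> nlinarith

theorem arcParam_image_Ioo {a : ℝ} (ha : 0 ≤ a) (ha1 : a < 1) :
    arcParam √(1 - a ^ 2) '' Set.Ioo 0 Real.pi =
      Set.Ioo (arcAngle a) (2 * Real.pi - arcAngle a) := by
  set c := √(1 - a ^ 2) with hc
  have hcos : Real.cos (Real.arcsin a) = c := Real.cos_arcsin a
  have hc0 : 0 < c := Real.sqrt_pos.2 (by nlinarith)
  have hc1 : c ≤ 1 := Real.sqrt_le_one.2 (by nlinarith)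
  have h0 : 0 ≤ Real.arcsin a := Real.arcsin_nonneg.2 ha
  have h2 : Real.arcsin a ≤ Real.pi / 2 := Real.arcsin_le_pi_div_two a
  have hpi := Real.pi_pos
  have hac : Real.arccos c = Real.arcsin a := by
    rw [← hcos, Real.arccos_cos h0 (by linarith)]
  ext θ
  simp only [Set.mem_image, arcAngle, arcParam]
  constructor
  · rintro ⟨φ, hφ, rfl⟩
    obtain ⟨h3, h4⟩ := abs_cos_lt_one_of_mem_Ioo hφ
    have h5 : c * Real.cos φ < c := by nlinarith
    have h6 : -c < c * Real.cos φ := by nlinarith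
    have h7 := Real.strictAntiOn_arccos (a := c * Real.cos φ) (b := c)
      ⟨by linarith, by linarith⟩ ⟨by linarith, hc1⟩ h5
    have h8 := Real.strictAntiOn_arccos (a := -c) (b := c * Real.cos φ)
      ⟨by linarith, by linarith⟩ ⟨by linarith, by linarith⟩ h6
    rw [Real.arccos_neg, hac] at h8
    rw [hac] at h7
    constructor <;> linarith
  · rintro ⟨h3, h4⟩
    have h5 : Real.cos (θ / 2) < c := by
      rw [← hcos]
      exact Real.strictAntiOn_cos ⟨h0, by linarith⟩ ⟨by linarith, by linarith⟩ (by linarith)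
    have h6 : -c < Real.cos (θ / 2) := by
      rw [← hcos, ← Real.cos_pi_sub]
      exact Real.strictAntiOn_cos ⟨by linarith, by linarith⟩ ⟨by linarith, by linarith⟩
        (by linarith)
    have h7 : Real.cos (θ / 2) / c < 1 := (div_lt_one hc0).2 h5
    have h8 : -1 < Real.cos (θ / 2) / c := by rw [lt_div_iff₀ hc0]; linarith
    refine ⟨Real.arccos (Real.cos (θ / 2) / c), ⟨Real.arccos_pos.2 h7, ?_⟩, ?_⟩
    · refine lt_of_le_of_ne (Real.arccos_le_pi _) fun h => ?_
      rw [Real.arccos_eq_pi] at h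
      linarith
    · rw [Real.cos_arccos h8.le h7.le, mul_div_cancel₀ _ hc0.ne',
        Real.arccos_cos (by linarith) (by linarith)]
      ring

theorem hasDerivAt_arcParam {c φ : ℝ} (hc : 0 < c) (hc1 : c ≤ 1)
    (hφ : φ ∈ Set.Ioo 0 Real.pi) :
    HasDerivAt (arcParam c)
      (2 * (c * Real.sin φ / √(1 - (c * Real.cos φ) ^ 2))) φ := by
  obtain ⟨h3, h4⟩ := abs_cos_lt_one_of_mem_Ioo hφ
  have h1 : c * Real.cos φ ≠ -1 := by nlinarith
  have h2 : c * Real.cos φ ≠ 1 := by nlinarith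
  have := ((Real.hasDerivAt_arccos h1 h2).comp φ ((Real.hasDerivAt_cos φ).const_mul c)).const_mul 2
  convert! this using 1
  ring

/-- With `cos(θ/2) = c cos φ`, the square root in the density is `c sin φ` and `sin(θ/2) = √(1 - c²
cos² φ)`; both cancel against the Jacobian. -/
theorem deriv_arcParam_mul_arcDensity {a φ : ℝ} (ha : 0 ≤ a) (ha1 : a < 1)
    (hφ : φ ∈ Set.Ioo 0 Real.pi) :
    2 * (√(1 - a ^ 2) * Real.sin φ / √(1 - (√(1 - a ^ 2) * Real.cos φ) ^ 2)) *
      arcDensity a (arcParam √(1 - a ^ 2) φ) = Real.pi⁻¹ := by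
  set c := √(1 - a ^ 2) with hc
  have hc0 : 0 < c := Real.sqrt_pos.2 (by nlinarith)
  have hc1 : c ≤ 1 := Real.sqrt_le_one.2 (by nlinarith)
  obtain ⟨h3, h4⟩ := abs_cos_lt_one_of_mem_Ioo hφ
  have hs := Real.sin_pos_of_mem_Ioo hφ
  have hx1 : -1 < c * Real.cos φ := by nlinarith
  have hx2 : c * Real.cos φ < 1 := by nlinarith
  have hr : 0 < √(1 - (c * Real.cos φ) ^ 2) := Real.sqrt_pos.2 (by nlinarith)
  have hd : √(c ^ 2 - (c * Real.cos φ) ^ 2) = c * Real.sin φ := by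
    rw [← Real.sqrt_sq (mul_pos hc0 hs).le]
    congr 1
    linear_combination (c ^ 2) * (-Real.sin_sq_add_cos_sq φ)
  have e1 : arcAngle a / 2 = Real.arcsin a := by unfold arcAngle; ring
  have e2 : arcParam c φ / 2 = Real.arccos (c * Real.cos φ) := by unfold arcParam; ring
  rw [arcDensity, e1, e2, Real.cos_arcsin, ← hc, Real.cos_arccos hx1.le hx2.le,
    Real.sin_arccos, hd]
  have hpi := Real.pi_pos
  generalize √(1 - (c * Real.cos φ) ^ 2) = R at hr ⊢
  field_simp

/-- Each `ν_a` is the image of the uniform distribution on `(0, π)` under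
`φ ↦ exp (2 i arccos (√(1 - a²) cos φ))`. -/
theorem arcMeasure_eq_map {a : ℝ} (ha : 0 ≤ a) (ha1 : a ≤ 1) :
    arcMeasure a = (ENNReal.ofReal Real.pi⁻¹ • volume.restrict (Set.Ioo 0 Real.pi)).map
      fun φ : ℝ => Complex.exp (arcParam √(1 - a ^ 2) φ * Complex.I) := by
  have hpi := Real.pi_pos
  rcases ha1.eq_or_lt with rfl | ha1
  -- For `a = 1` the parameter `c` vanishes and the map is constantly `-1`.
  · have hconst : (fun φ : ℝ => Complex.exp (arcParam √(1 - 1 ^ 2) φ * Complex.I)) =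
        fun _ => (-1 : ℂ) := by
      funext φ
      have : arcParam √(1 - 1 ^ 2) φ = Real.pi := by
        simp [arcParam]
        ring
      rw [this, Complex.exp_pi_mul_I]
    rw [hconst, Measure.map_const, arcMeasure, if_pos rfl]
    simp only [Measure.smul_apply, Measure.restrict_apply_univ, Real.volume_Ioo, sub_zero,
      smul_eq_mul]
    rw [← ENNReal.ofReal_mul (by positivity), inv_mul_cancel₀ hpi.ne']
    simp
  set c := √(1 - a ^ 2) with hc
  have hc0 : 0 < c := Real.sqrt_pos.2 (by nlinarith)
  have hc1 : c ≤ 1 := Real.sqrt_le_one.2 (by nlinarith)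
  have hexp : Measurable fun θ : ℝ => Complex.exp (θ * Complex.I) := by fun_prop
  have hT : Measurable (arcParam c) := (continuous_arcParam c).measurable
  have hcomp : (fun φ : ℝ => Complex.exp (arcParam c φ * Complex.I)) =
      (fun θ : ℝ => Complex.exp (θ * Complex.I)) ∘ arcParam c := rfl
  rw [hcomp, ← Measure.map_map hexp hT, arcMeasure, if_neg ha1.ne]
  congr 1
  ext s hs
  rw [withDensity_apply _ hs, ← lintegral_indicator hs, Measure.restrict_congr_set
    Ioo_ae_eq_Icc.symm, ← arcParam_image_Ioo ha ha1,
    lintegral_image_eq_lintegral_abs_deriv_mul measurableSet_Ioo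
      (fun φ hφ => (hasDerivAt_arcParam hc0 hc1 hφ).hasDerivWithinAt) (arcParam_injOn hc0 hc1),
    Measure.map_apply hT hs, Measure.smul_apply, smul_eq_mul,
    ← setLIntegral_one, ← lintegral_const_mul _ measurable_const,
    ← lintegral_indicator (hT hs)]
  refine setLIntegral_congr_fun measurableSet_Ioo fun φ hφ => ?_
  have hs := Real.sin_pos_of_mem_Ioo hφ
  by_cases h : arcParam c φ ∈ s
  · have h' : φ ∈ arcParam c ⁻¹' s := h
    rw [Set.indicator_of_mem h, Set.indicator_of_mem h', abs_of_nonneg (by positivity),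
      ← ENNReal.ofReal_mul (by positivity), deriv_arcParam_mul_arcDensity ha ha1 hφ, mul_one]
  · have h' : φ ∉ arcParam c ⁻¹' s := h
    rw [Set.indicator_of_notMem h, Set.indicator_of_notMem h', mul_zero]

theorem isProbabilityMeasure_arcMeasure {a : ℝ} (ha : 0 ≤ a) (ha1 : a ≤ 1) :
    IsProbabilityMeasure (arcMeasure a) := by
  have hpi := Real.pi_pos
  rw [arcMeasure_eq_map ha ha1]
  have : IsProbabilityMeasure
      (ENNReal.ofReal Real.pi⁻¹ • volume.restrict (Set.Ioo 0 Real.pi)) := by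
    constructor
    simp only [Measure.smul_apply, Measure.restrict_apply_univ, Real.volume_Ioo, sub_zero,
      smul_eq_mul]
    rw [← ENNReal.ofReal_mul (by positivity), inv_mul_cancel₀ hpi.ne', ENNReal.ofReal_one]
  refine Measure.isProbabilityMeasure_map (Continuous.aemeasurable ?_)
  have := continuous_arcParam √(1 - a ^ 2)
  fun_prop

theorem ae_norm_eq_one_arcMeasure {a : ℝ} (ha : 0 ≤ a) (ha1 : a ≤ 1) :
    ∀ᵐ z ∂(arcMeasure a), ‖z‖ = 1 := by
  rw [arcMeasure_eq_map ha ha1]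
  have := continuous_arcParam √(1 - a ^ 2)
  rw [ae_map_iff (Continuous.aemeasurable (by fun_prop))
    (measurableSet_eq_fun measurable_norm measurable_const)]
  exact Eventually.of_forall fun φ => Complex.norm_exp_ofReal_mul_I _

theorem integral_pow_arcMeasure {a : ℝ} (ha : 0 ≤ a) (ha1 : a ≤ 1) (m : ℕ) :
    ∫ z, z ^ m ∂(arcMeasure a) = (Real.pi : ℂ)⁻¹ *
      ∫ φ in (0 : ℝ)..Real.pi, Complex.exp (arcParam √(1 - a ^ 2) φ * Complex.I) ^ m := by
  have := continuous_arcParam √(1 - a ^ 2)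
  rw [arcMeasure_eq_map ha ha1, integral_map (Continuous.aemeasurable (by fun_prop))
    (Continuous.aestronglyMeasurable (by fun_prop)), integral_smul_measure,
    ENNReal.toReal_ofReal (inv_nonneg.2 Real.pi_pos.le),
    intervalIntegral.integral_of_le Real.pi_pos.le, integral_Ioc_eq_integral_Ioo]
  simp

/-! ### Moments of the arc measures -/

theorem integral_exp_two_mul_I_pow {k : ℤ} (hk : k ≠ 0) :
    ∫ φ in (0 : ℝ)..Real.pi, Complex.exp (2 * φ * Complex.I) ^ k = 0 := by
  have hne : (k : ℂ) * (2 * Complex.I) ≠ 0 := by simp [hk]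
  have : ∀ φ : ℝ, Complex.exp (2 * φ * Complex.I) ^ k =
      Complex.exp ((k : ℂ) * (2 * Complex.I) * φ) := fun φ => by
    rw [← Complex.exp_int_mul]
    congr 1
    ring
  simp only [this]
  rw [integral_exp_mul_complex hne]
  have h1 : Complex.exp ((k : ℂ) * (2 * Complex.I) * Real.pi) = 1 := by
    rw [Complex.exp_eq_one_iff]
    exact ⟨k, by ring⟩
  rw [h1]
  simp

/-- The coefficients of `negLogDeriv (1 + u r)`, `r(0) = 0`, are polynomials in `u` without
constant term. -/
theorem exists_poly_coeff_negLogDeriv {r : PowerSeries ℂ}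
    (hr : PowerSeries.constantCoeff r = 0) (m : ℕ) :
    ∃ p : ℂ[X], ∀ u : ℂ,
      PowerSeries.coeff m (negLogDeriv (1 + PowerSeries.C u * r)) = u * p.eval u := by
  induction m using Nat.strong_induction_on with
  | _ m ih =>
    choose! p hp using ih
    cases m with
    | zero => exact ⟨0, fun u => by rw [coeff_zero_negLogDeriv]; simp⟩
    | succ m =>
      refine ⟨-C ((m + 1) * PowerSeries.coeff (m + 1) r) -
        ∑ q ∈ Finset.HasAntidiagonal.antidiagonal m,
          X * p q.1 * C (PowerSeries.coeff (q.2 + 1) r), fun u => ?_⟩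
      have hc : ∀ j, PowerSeries.coeff (j + 1) (1 + PowerSeries.C u * r) =
          u * PowerSeries.coeff (j + 1) r := fun j => by
        simp [PowerSeries.coeff_one]
      rw [coeff_negLogDeriv_succ (by simp [hr]), eval_sub, eval_finsetSum, mul_sub,
        Finset.mul_sum]
      congr 1
      · rw [hc]
        simp only [eval_neg, eval_C]
        ring
      · refine Finset.sum_congr rfl fun q hq => ?_
        have hq' := Finset.HasAntidiagonal.mem_antidiagonal.1 hq
        rw [hc, hp q.1 (by omega)]
        simp only [eval_mul, eval_C, eval_X]
        ring

/-- Only nonzero powers of `e^{2iφ}` occur, and each has mean zero over the period `[0, π]`. The two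
signs serve the factors with `u` and `u⁻¹`. -/
theorem integral_mul_eval_zpow (p : ℂ[X]) {ε : ℤ} (hε : ε = 1 ∨ ε = -1) :
    ∫ φ in (0 : ℝ)..Real.pi, Complex.exp (2 * φ * Complex.I) ^ ε *
      p.eval (Complex.exp (2 * φ * Complex.I) ^ ε) = 0 := by
  have h : ∀ φ : ℝ, Complex.exp (2 * φ * Complex.I) ^ ε *
      p.eval (Complex.exp (2 * φ * Complex.I) ^ ε) =
      ∑ i ∈ Finset.range (p.natDegree + 1),
        p.coeff i * Complex.exp (2 * φ * Complex.I) ^ (ε * (i + 1 : ℕ)) := by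
    intro φ
    rw [eval_eq_sum_range, Finset.mul_sum]
    refine Finset.sum_congr rfl fun i _ => ?_
    rw [zpow_mul, zpow_natCast, pow_succ]
    ring
  simp only [h]
  rw [intervalIntegral.integral_finsetSum]
  · refine Finset.sum_eq_zero fun i _ => ?_
    rw [intervalIntegral.integral_const_mul, integral_exp_two_mul_I_pow, mul_zero]
    rcases hε with rfl | rfl <;> simp <;> omega
  · intro i _
    refine Continuous.intervalIntegrable ?_ _ _
    refine continuous_const.mul (Continuous.zpow₀ (by fun_prop) _ fun φ => ?_)
    exact Or.inl (Complex.exp_ne_zero _)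

/-- The moments of `ν_{|α|}` are the coefficients of the negative logarithmic derivative of the
limiting factor. -/
theorem integral_pow_arcMeasure_norm {α : ℂ} (hα : ‖α‖ ≤ 1) (m : ℕ) :
    ∫ z, z ^ (m + 1) ∂(arcMeasure ‖α‖) =
      PowerSeries.coeff (m + 1) (negLogDeriv (fixedFactor α)) := by
  rw [integral_pow_arcMeasure (norm_nonneg α) hα]
  set c := √(1 - ‖α‖ ^ 2) with hc
  have hc2 : c ^ 2 = 1 - ‖α‖ ^ 2 := Real.sq_sqrt (by nlinarith [norm_nonneg α])
  have hc1 : c ≤ 1 := Real.sqrt_le_one.2 (by nlinarith [norm_nonneg α])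
  have hc0 : 0 ≤ c := Real.sqrt_nonneg _
  set h := fixedFactor α with hh
  have hh1 : PowerSeries.constantCoeff h = 1 := constantCoeff_fixedFactor α
  set q := h - (1 + PowerSeries.X) with hq
  have hhq : h * q = -(PowerSeries.C ((c : ℂ) ^ 2) * PowerSeries.X) := by
    have : ((c : ℂ) ^ 2) = 1 - (‖α‖ : ℂ) ^ 2 := by exact_mod_cast hc2
    rw [this]
    exact fixedFactor_mul_self α
  -- `h` and `-q` are the roots' two branches: `h - q = 1 + X` and `h q = -c² X`. The ratio `r = q /
  -- h` makes `h + u q = h (1 + u r)`.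
  set r := q * h⁻¹ with hr
  have hr0 : PowerSeries.constantCoeff r = 0 := by simp [hr, hq, hh1]
  have hrq : h * r = q := by
    rw [hr, mul_left_comm, PowerSeries.mul_inv_cancel _ (by simp [hh1]), mul_one]
  obtain ⟨p, hp⟩ := exists_poly_coeff_negLogDeriv hr0 (m + 1)
  set E : ℝ → ℂ := fun φ => Complex.exp (arcParam c φ * Complex.I) with hE
  set u : ℝ → ℂ := fun φ => Complex.exp (2 * φ * Complex.I) with hu
  have hEu : ∀ φ, E φ + (E φ)⁻¹ = (c : ℂ) ^ 2 * (u φ + (u φ)⁻¹) + 2 * (c : ℂ) ^ 2 - 2 := by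
    intro φ
    have h1 : E φ + (E φ)⁻¹ = ((2 * Real.cos (arcParam c φ) : ℝ) : ℂ) := by
      rw [hE]
      push_cast
      rw [Complex.two_cos, ← Complex.exp_neg, neg_mul]
    have h2 : u φ + (u φ)⁻¹ = ((2 * Real.cos (2 * φ) : ℝ) : ℂ) := by
      rw [hu]
      push_cast
      rw [Complex.two_cos, ← Complex.exp_neg, neg_mul]
    rw [h1, h2, arcParam, Real.cos_two_mul, Real.cos_two_mul, Real.cos_arccos]
    · push_cast; ring
    · nlinarith [Real.neg_one_le_cos φ, Real.cos_le_one φ]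
    · nlinarith [Real.neg_one_le_cos φ, Real.cos_le_one φ]
  have hkey : ∀ φ, E φ ^ (m + 1) + (E φ)⁻¹ ^ (m + 1) =
      2 * PowerSeries.coeff (m + 1) (negLogDeriv h) +
        (u φ ^ (1 : ℤ) * p.eval (u φ ^ (1 : ℤ)) +
          u φ ^ (-1 : ℤ) * p.eval (u φ ^ (-1 : ℤ))) := by
    intro φ
    have hE0 : E φ ≠ 0 := Complex.exp_ne_zero _
    have hu0 : u φ ≠ 0 := Complex.exp_ne_zero _
    -- Both sides equal `1 - (E + E⁻¹) X + X²`; the middle coefficient is matched by `hEu`.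
    have hprod : (1 - PowerSeries.C (E φ) * PowerSeries.X) *
        (1 - PowerSeries.C (E φ)⁻¹ * PowerSeries.X) =
        h * h * ((1 + PowerSeries.C (u φ) * r) * (1 + PowerSeries.C (u φ)⁻¹ * r)) := by
      have e1 : PowerSeries.C (E φ) * PowerSeries.C (E φ)⁻¹ = 1 := by
        rw [← map_mul, mul_inv_cancel₀ hE0, map_one]
      have e2 : PowerSeries.C (u φ) * PowerSeries.C (u φ)⁻¹ = 1 := by
        rw [← map_mul, mul_inv_cancel₀ hu0, map_one]
      have e3 : PowerSeries.C (E φ) + PowerSeries.C (E φ)⁻¹ = PowerSeries.C ((c : ℂ) ^ 2) *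
          (PowerSeries.C (u φ) + PowerSeries.C (u φ)⁻¹) + 2 * PowerSeries.C ((c : ℂ) ^ 2) - 2 := by
        rw [← map_add, hEu φ]
        simp only [map_add, map_sub, map_mul, map_ofNat]
      have e4 : h * h * ((1 + PowerSeries.C (u φ) * r) * (1 + PowerSeries.C (u φ)⁻¹ * r)) =
          (h + PowerSeries.C (u φ) * q) * (h + PowerSeries.C (u φ)⁻¹ * q) := by
        rw [← hrq]; ring
      have e5 : h - q = 1 + PowerSeries.X := by rw [hq]; ring
      rw [e4]
      linear_combination PowerSeries.X ^ 2 * e1 - PowerSeries.X * e3 - q ^ 2 * e2 -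
        (PowerSeries.C (u φ) + PowerSeries.C (u φ)⁻¹ + 2) * hhq -
        (h - q + 1 + PowerSeries.X) * e5
    have hL := congrArg (fun f => PowerSeries.coeff (m + 1) (negLogDeriv f)) hprod
    rw [negLogDeriv_mul (by simp) (by simp), negLogDeriv_mul (by simp [hh1]) (by simp [hr0]),
      negLogDeriv_mul (by simp [hh1]) (by simp [hh1]),
      negLogDeriv_mul (by simp [hr0]) (by simp [hr0])] at hL
    simp only [map_add, coeff_negLogDeriv_linear, hp] at hL
    rw [hL, zpow_one, zpow_neg_one]
    ring
  have hcE : Continuous E := by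
    have := continuous_arcParam c
    rw [hE]; fun_prop
  have hcu : Continuous u := by rw [hu]; fun_prop
  have hu0 : ∀ φ, u φ ≠ 0 := fun φ => Complex.exp_ne_zero _
  have hE0 : ∀ φ, E φ ≠ 0 := fun φ => Complex.exp_ne_zero _
  -- Under `φ ↦ π - φ` the angle `arcParam c φ` becomes `2π` minus itself, so `E` becomes `E⁻¹`.
  have hsymm : ∫ φ in (0 : ℝ)..Real.pi, (E φ)⁻¹ ^ (m + 1) =
      ∫ φ in (0 : ℝ)..Real.pi, E φ ^ (m + 1) := by
    have := intervalIntegral.integral_comp_sub_left (a := 0) (b := Real.pi)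
      (fun φ => E φ ^ (m + 1)) Real.pi
    rw [sub_self, sub_zero] at this
    rw [← this]
    congr 1
    funext φ
    congr 1
    rw [hE]
    simp only
    rw [arcParam, arcParam, Real.cos_pi_sub, mul_neg, Real.arccos_neg, ← Complex.exp_neg,
      Complex.exp_eq_exp_iff_exists_int]
    exact ⟨-1, by push_cast; ring⟩
  have hint := congrArg (fun F : ℝ → ℂ => ∫ φ in (0 : ℝ)..Real.pi, F φ) (funext hkey)
  have hcz : ∀ ε : ℤ, Continuous fun φ => u φ ^ ε := fun ε =>
    hcu.zpow₀ ε fun φ => Or.inl (hu0 φ)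
  have hcp : ∀ ε : ℤ, IntervalIntegrable (fun φ => u φ ^ ε * p.eval (u φ ^ ε)) volume 0
      Real.pi := fun ε =>
    ((hcz ε).mul (p.continuous.comp (hcz ε))).intervalIntegrable _ _
  have hiE : IntervalIntegrable (fun φ => E φ ^ (m + 1)) volume 0 Real.pi :=
    (hcE.pow _).intervalIntegrable _ _
  have hiE' : IntervalIntegrable (fun φ => (E φ)⁻¹ ^ (m + 1)) volume 0 Real.pi :=
    ((hcE.inv₀ hE0).pow _).intervalIntegrable _ _
  rw [intervalIntegral.integral_add hiE hiE', hsymm,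
    intervalIntegral.integral_add intervalIntegrable_const ((hcp 1).add (hcp (-1))),
    intervalIntegral.integral_add (hcp 1) (hcp (-1)), integral_mul_eval_zpow p (Or.inl rfl),
    integral_mul_eval_zpow p (Or.inr rfl), intervalIntegral.integral_const] at hint
  have hpi : (Real.pi : ℂ) ≠ 0 := by exact_mod_cast Real.pi_pos.ne'
  rw [sub_zero, Complex.real_smul] at hint
  field_simp
  linear_combination hint / 2

/-! ### Zero-counting measures and concentration on the circle -/

theorem integrable_and_integral_sum_dirac {E : Type*} [NormedAddCommGroup E] [NormedSpace ℝ E]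
    [CompleteSpace E] (f : ℂ → E) (s : Multiset ℂ) :
    Integrable f (s.map fun z => Measure.dirac z).sum ∧
      ∫ z, f z ∂(s.map fun z => Measure.dirac z).sum = (s.map f).sum := by
  induction s using Multiset.induction_on with
  | empty => simp
  | cons w s ih =>
    have hw : Integrable f (Measure.dirac w) := integrable_dirac (by simp)
    rw [Multiset.map_cons, Multiset.sum_cons, Multiset.map_cons, Multiset.sum_cons]
    refine ⟨hw.add_measure ih.1, ?_⟩
    rw [integral_add_measure hw ih.1, ih.2, integral_dirac]

theorem integral_opucZeroMeasure {E : Type*} [NormedAddCommGroup E] [NormedSpace ℝ E]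
    [CompleteSpace E] (f : ℂ → E) (a : ℕ → ℂ) (n : ℕ) :
    ∫ z, f z ∂(opucZeroMeasure a n) = (n : ℝ)⁻¹ • ((opuc a n).roots.map f).sum := by
  rw [opucZeroMeasure, integral_smul_measure, (integrable_and_integral_sum_dirac f _).2]
  simp

theorem sum_dirac_univ (s : Multiset ℂ) :
    (s.map fun z => Measure.dirac z).sum Set.univ = (Multiset.card s : ℝ≥0∞) := by
  induction s using Multiset.induction_on with
  | empty => simp
  | cons w s ih =>
    rw [Multiset.map_cons, Multiset.sum_cons, Measure.add_apply, ih, Multiset.card_cons]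
    simp [add_comm]

theorem isProbabilityMeasure_opucZeroMeasure (a : ℕ → ℂ) {n : ℕ} (hn : 1 ≤ n) :
    IsProbabilityMeasure (opucZeroMeasure a n) := by
  constructor
  rw [opucZeroMeasure, Measure.smul_apply, sum_dirac_univ, card_roots_opuc, smul_eq_mul]
  exact ENNReal.inv_mul_cancel (by simp; omega) (by simp)

theorem ae_sum_dirac {s : Multiset ℂ} {p : ℂ → Prop} (h : ∀ z ∈ s, p z) :
    ∀ᵐ z ∂(s.map fun z => Measure.dirac z).sum, p z := by
  induction s using Multiset.induction_on with
  | empty => simp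
  | cons w s ih =>
    rw [Multiset.map_cons, Multiset.sum_cons, ae_add_measure_iff, ae_dirac_eq]
    exact ⟨h w (Multiset.mem_cons_self w s), ih fun z hz => h z (Multiset.mem_cons_of_mem hz)⟩

theorem ae_norm_le_one_opucZeroMeasure {a : ℕ → ℂ} (ha : ∀ n, ‖a n‖ < 1) (n : ℕ) :
    ∀ᵐ z ∂(opucZeroMeasure a n), ‖z‖ ≤ 1 :=
  Measure.ae_smul_measure (ae_sum_dirac fun _ hz => (norm_lt_one_of_mem_roots_opuc ha hz).le) _

/-- Factorwise `x ≤ exp(x - 1)`. This converts the known product of the moduli into control of the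
sum of the distances to the circle. -/
theorem prod_norm_le_exp (s : Multiset ℂ) :
    (s.map fun z => ‖z‖).prod ≤ Real.exp (-(s.map fun z => 1 - ‖z‖).sum) := by
  induction s using Multiset.induction_on with
  | empty => simp
  | cons w s ih =>
    rw [Multiset.map_cons, Multiset.prod_cons, Multiset.map_cons, Multiset.sum_cons, neg_add,
      Real.exp_add]
    refine mul_le_mul ?_ ih (Multiset.prod_nonneg ?_) (Real.exp_nonneg _)
    · have := Real.add_one_le_exp (-(1 - ‖w‖))
      linarith
    · intro x hx
      obtain ⟨z, _, rfl⟩ := Multiset.mem_map.1 hx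
      exact norm_nonneg z

/-- If `|α_{n-1,N}|^{1/n} → 1`, the zeros concentrate near the unit circle. -/
theorem ratioTendsto_integral_one_sub_norm {a : ℕ → ℕ → ℂ} (ha : ∀ n N, ‖a n N‖ < 1) {t : ℝ}
    (hroot : RatioTendsto (fun n N => ‖a (n - 1) N‖ ^ (1 / (n : ℝ))) t 1) :
    RatioTendsto (fun n N => ∫ z, (1 - ‖z‖) ∂(opucZeroMeasure (fun k => a k N) n)) t 0 := by
  intro n N hn hN hs
  have hlow := hroot n N hn hN hs
  set d : ℕ → ℝ := fun j => ∫ z, (1 - ‖z‖) ∂(opucZeroMeasure (fun k => a k (N j)) (n j)) with hd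
  have hexp : Tendsto (fun j => Real.exp (-d j)) atTop (𝓝 1) := by
    -- Squeeze: `|α_{n-1,N}|^{1/n} ≤ exp(-d) ≤ 1`.
    refine tendsto_of_tendsto_of_tendsto_of_le_of_le' hlow tendsto_const_nhds ?_ ?_
    · filter_upwards [hn.eventually_ge_atTop 1] with j hj
      obtain ⟨k, hk⟩ := Nat.exists_eq_add_of_le' hj
      have hpos : (0 : ℝ) < n j := by exact_mod_cast hj
      have h1 := prod_norm_le_exp (opuc (fun k => a k (N j)) (n j)).roots
      have h2 : ((opuc (fun k => a k (N j)) (n j)).roots.map fun z => ‖z‖).prod =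
          ‖a (n j - 1) (N j)‖ := by
        rw [hk]
        exact prod_norm_roots_opuc_succ (fun k => a k (N j)) k
      rw [h2] at h1
      have h3 := Real.rpow_le_rpow (norm_nonneg _) h1 (by positivity : 0 ≤ 1 / (n j : ℝ))
      refine h3.trans_eq ?_
      rw [← Real.exp_mul, hd]
      simp only [integral_opucZeroMeasure, smul_eq_mul]
      congr 1
      ring
    · refine Eventually.of_forall fun j => Real.exp_le_one_iff.2 (neg_nonpos.2 ?_)
      refine integral_nonneg_of_ae ?_
      filter_upwards [ae_norm_le_one_opucZeroMeasure (fun k => ha k (N j)) (n j)] with z hz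
      simpa using hz
  have := ((Real.continuousAt_log one_ne_zero).tendsto.comp hexp).neg
  simpa [Function.comp_def] using this

/-! ### The averaged arc measure -/

section Average

variable {α : ℝ → ℂ} {t : ℝ}

/-- The measures `ν_{|α(s)|}`, `s ∈ [0, t]`, agree almost everywhere with a Markov kernel. -/
theorem exists_kernel_arcMeasure
    (hα_meas : NullMeasurable α (volume.restrict (Set.Icc 0 t)))
    (hα_disk : ∀ s ∈ Set.Icc 0 t, ‖α s‖ ≤ 1) :
    ∃ κ : ProbabilityTheory.Kernel ℝ ℂ, ProbabilityTheory.IsMarkovKernel κ ∧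
      (∀ s, ∀ᵐ z ∂(κ s), ‖z‖ = 1) ∧
      (fun s => arcMeasure ‖α s‖) =ᵐ[volume.restrict (Set.Icc 0 t)] κ := by
  have hm : AEMeasurable (fun s => ‖α s‖) (volume.restrict (Set.Icc 0 t)) :=
    hα_meas.aemeasurable.norm
  -- A measurable representative of `‖α‖` is clamped to `[0, 1]`, so that every fibre, and not only
  -- almost every one, is a probability measure on the circle.
  set b : ℝ → ℝ := fun s => max 0 (min 1 (hm.mk _ s)) with hb
  have hbm : Measurable b := measurable_const.max (measurable_const.min hm.measurable_mk)
  have hb0 : ∀ s, 0 ≤ b s := fun s => le_max_left _ _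
  have hb1 : ∀ s, b s ≤ 1 := fun s => max_le zero_le_one (min_le_left _ _)
  refine ⟨⟨fun s => arcMeasure (b s), measurable_arcMeasure.comp hbm⟩,
    ⟨fun s => isProbabilityMeasure_arcMeasure (hb0 s) (hb1 s)⟩,
    fun s => ae_norm_eq_one_arcMeasure (hb0 s) (hb1 s), ?_⟩
  filter_upwards [hm.ae_eq_mk, ae_restrict_mem measurableSet_Icc] with s hs hmem
  have : b s = ‖α s‖ := by
    rw [hb]
    simp only
    rw [← hs, min_eq_right (hα_disk s hmem), max_eq_right (norm_nonneg _)]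
  rw [← this]
  rfl

theorem isProbabilityMeasure_averagedArcMeasure (ht : 0 < t)
    (hα_meas : NullMeasurable α (volume.restrict (Set.Icc 0 t)))
    (hα_disk : ∀ s ∈ Set.Icc 0 t, ‖α s‖ ≤ 1) :
    IsProbabilityMeasure (averagedArcMeasure α t) := by
  obtain ⟨κ, _, -, hκ⟩ := exists_kernel_arcMeasure hα_meas hα_disk
  constructor
  rw [averagedArcMeasure, Measure.bind_congr_right hκ, Measure.smul_apply,
    Measure.comp_apply_univ, Measure.restrict_apply_univ, Real.volume_Icc, sub_zero, smul_eq_mul]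
  exact ENNReal.inv_mul_cancel (by simpa using ht) ENNReal.ofReal_ne_top

theorem ae_norm_eq_one_averagedArcMeasure
    (hα_meas : NullMeasurable α (volume.restrict (Set.Icc 0 t)))
    (hα_disk : ∀ s ∈ Set.Icc 0 t, ‖α s‖ ≤ 1) :
    ∀ᵐ z ∂(averagedArcMeasure α t), ‖z‖ = 1 := by
  obtain ⟨κ, _, hκ1, hκ⟩ := exists_kernel_arcMeasure hα_meas hα_disk
  rw [averagedArcMeasure, Measure.bind_congr_right hκ]
  exact Measure.ae_smul_measure (Measure.ae_comp_of_ae_ae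
    (measurableSet_eq_fun measurable_norm measurable_const) (Eventually.of_forall hκ1)) _

theorem integral_pow_averagedArcMeasure (ht : 0 < t)
    (hα_meas : NullMeasurable α (volume.restrict (Set.Icc 0 t)))
    (hα_disk : ∀ s ∈ Set.Icc 0 t, ‖α s‖ ≤ 1) (m : ℕ) :
    ∫ z, z ^ m ∂(averagedArcMeasure α t) =
      (t : ℂ)⁻¹ * ∫ s in Set.Icc 0 t, ∫ z, z ^ m ∂(arcMeasure ‖α s‖) := by
  obtain ⟨κ, _, hκ1, hκ⟩ := exists_kernel_arcMeasure hα_meas hα_disk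
  have hint : Integrable (fun z : ℂ => z ^ m) ((volume.restrict (Set.Icc 0 t)).bind κ) := by
    refine Integrable.of_bound (by fun_prop) 1 (Measure.ae_comp_of_ae_ae
      (measurableSet_le (by fun_prop) measurable_const) (Eventually.of_forall fun s => ?_))
    filter_upwards [hκ1 s] with z hz
    simp [hz]
  rw [averagedArcMeasure, Measure.bind_congr_right hκ, integral_smul_measure]
  -- Viewing the average as a composition with a constant kernel makes Fubini for kernels
  -- applicable.
  rw [Measure.comp_eq_comp_const_apply] at hint ⊢
  rw [ProbabilityTheory.Kernel.integral_comp hint, ProbabilityTheory.Kernel.const_apply,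
    ENNReal.toReal_inv, ENNReal.toReal_ofReal ht.le, Complex.real_smul, Complex.ofReal_inv]
  congr 1
  refine integral_congr_ae ?_
  filter_upwards [hκ] with s hs
  rw [← hs]

end Average

/-! ### Convergence of moments and conclusion -/

theorem ratioTendsto_moment {t : ℝ} (ht : 0 < t) {α : ℝ → ℂ}
    (hα_meas : NullMeasurable α (volume.restrict (Set.Icc 0 t)))
    (hα_disk : ∀ s ∈ Set.Icc 0 t, ‖α s‖ ≤ 1)
    {a : ℕ → ℕ → ℂ} (ha : ∀ n N, ‖a n N‖ < 1)
    (hlim : ∀ᵐ s ∂(volume.restrict (Set.Icc 0 t)), RatioTendsto a s (α s)) (m : ℕ) :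
    RatioTendsto (fun n N => ∫ z, z ^ (m + 1) ∂(opucZeroMeasure (fun k => a k N) n)) t
      (∫ z, z ^ (m + 1) ∂(averagedArcMeasure α t)) := by
  obtain ⟨B, hB⟩ := exists_bound_coeff_negLogDeriv_opucFactor ha (m + 1)
  have hav := ratioTendsto_average ht hB
    (hlim.mono fun s hs => ratioTendsto_coeff_negLogDeriv_opucFactor hs (m + 1))
  have hσ : ∫ s in Set.Icc 0 t, ∫ z, z ^ (m + 1) ∂(arcMeasure ‖α s‖) =
      ∫ s in Set.Icc 0 t, PowerSeries.coeff (m + 1) (negLogDeriv (fixedFactor (α s))) :=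
    setIntegral_congr_fun measurableSet_Icc fun s hs =>
      integral_pow_arcMeasure_norm (hα_disk s hs) m
  rw [integral_pow_averagedArcMeasure ht hα_meas hα_disk, hσ]
  convert! hav using 3 with n N
  rw [integral_opucZeroMeasure, sum_roots_opuc_pow, Complex.real_smul]
  simp

theorem theorem5p3 (t : ℝ) (ht : 0 < t) (α : ℝ → ℂ)
    (hα_meas : NullMeasurable α (volume.restrict (Set.Icc 0 t)))
    (hα_disk : ∀ s ∈ Set.Icc 0 t, ‖α s‖ ≤ 1)
    (a : ℕ → ℕ → ℂ) (ha : ∀ n N, ‖a n N‖ < 1)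
    (hlim : ∀ᵐ s ∂(volume.restrict (Set.Icc 0 t)), RatioTendsto a s (α s))
    (hroot : RatioTendsto (fun n N => ‖a (n - 1) N‖ ^ (1 / (n : ℝ))) t 1) :
    RatioWeakTendsto (fun n N => opucZeroMeasure (fun k => a k N) n) t
      (averagedArcMeasure α t) := by
  intro f n N hn hN hs
  -- For `n = 0` the zero-counting measure is zero rather than a probability measure, so an initial
  -- segment of the sequence is dropped.
  obtain ⟨J, hJ⟩ := eventually_atTop.1 (hn.eventually_ge_atTop 1)
  rw [← tendsto_add_atTop_iff_nat J]
  have hshift := tendsto_add_atTop_nat J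
  have hn' := hn.comp hshift
  have hN' := hN.comp hshift
  have hs' := hs.comp hshift
  have hprob : ∀ j, IsProbabilityMeasure
      (opucZeroMeasure (fun k => a k (N (j + J))) (n (j + J))) := fun j =>
    isProbabilityMeasure_opucZeroMeasure _ (hJ _ (Nat.le_add_left J j))
  have hσ := isProbabilityMeasure_averagedArcMeasure ht hα_meas hα_disk
  refine tendsto_integral_of_tendsto_moments
    (μ := fun j => opucZeroMeasure (fun k => a k (N (j + J))) (n (j + J)))
    (fun j => ae_norm_le_one_opucZeroMeasure (fun k => ha k _) _)
    (ae_norm_eq_one_averagedArcMeasure hα_meas hα_disk)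
    (ratioTendsto_integral_one_sub_norm ha hroot _ _ hn' hN' hs') (fun m => ?_) f
  cases m with
  | zero => simp
  | succ m => exact ratioTendsto_moment ht hα_meas hα_disk ha hlim m _ _ hn' hN' hs'
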